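/- Graphs are finite and undirected; multiple edges and loops are allowed. A loop adds $2$ to the degree of its vertex, and a $2$-factor of a graph is a spanning subgraph in which all vertices have degree $2$. For sets $X,Y$ of vertices, $E(X,Y)$ is the set of edges with one end in $X$ and the other end in $Y$, and $e(X,Y)=|E(X,Y)|$. Let $\mathcal{M}_2$ be the class of all graphs in which any two distinct vertices are joined by at most two edges and each vertex has at most one loop. A graph $G\in\mathcal{M}_2$ is *maximal without a $2$-factor within $\mathcal{M}_2$* if $G$ has no $2$-factor, but every graph in $\mathcal{M}_2$ obtained from $G$ by adding one new edge or loop (on the same vertex set) has a $2$-factor. **Theorem.** Let $G\in\mathcal{M}_2$. Let $A$ be the set of all vertices of $G$ without loops, let $B$ be the set of all vertices of $G$ that have a loop and are joined to every other vertex of $G$ by two edges, and let $C=V(G)\setminus(A\cup B)$. Let $\mathcal{C}=\{C_1,\dots,C_q\}$ be the set of the $q$ connected components of the induced subgraph $G[C]$. Then $G$ is maximal without a $2$-factor within $\mathcal{M}_2$ if and only if all of the following hold. 1. The set $A$ is independent. 2. Each component in $\mathcal{C}$ is complete, i.e. it has a loop at every vertex and two edges between any two distinct vertices. 3. For each $C_i\in\mathcal{C}$,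 the set of edges $E(A,V(C_i))$ is a matching of odd size. 4. $2|A|+q=2|B|+e(A,C)+2$. 5. For all $A'\subseteq A$ with $A'\neq\varnothing$ and all $\mathcal{C}'\subseteq\mathcal{C}$, $$2|A'|+|\mathcal{C}'|\ \ge\ 2+\sum_{C_i\in\mathcal{C}'}e(A',V(C_i)).$$ Moreover, for every $G\in\mathcal{M}_2$, the equation in 4 is equivalent to $|A|=|B|+1+\sum_{i=1}^q\tfrac12\bigl(e(A,V(C_i))-1\bigr)$. -/

import Mathlib

namespace Graph

variable {α β : Type*}

/-- The edges of `G` joining `x` and `y`. -/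
def linkSet (G : Graph α β) (x y : α) : Set β := {e | G.IsLink e x y}

/-- The class `M₂`: finite multigraphs in which any two distinct vertices are joined by at most
two edges and every vertex has at most one loop. -/
structure MemM2 (G : Graph α β) : Prop where
  finite_vertexSet : G.vertexSet.Finite
  finite_edgeSet : G.edgeSet.Finite
  ncard_linkSet_le : ∀ x y, x ≠ y → (G.linkSet x y).ncard ≤ 2
  ncard_loopSet_le : ∀ x, (G.loopSet x).ncard ≤ 1

/-- The degree of a vertex of a finite multigraph; a loop counts twice. -/
noncomputable def degree (G : Graph α β) (x : α) : ℕ :=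
  {e | G.IsNonloopAt e x}.ncard + 2 * (G.loopSet x).ncard

/-- A `k`-factor of `G`: a spanning subgraph in which all vertices have degree `k`. -/
def IsFactor (k : ℕ) (F G : Graph α β) : Prop :=
  F.IsSpanningSubgraph G ∧ ∀ x ∈ F.vertexSet, F.degree x = k

def HasFactor (k : ℕ) (G : Graph α β) : Prop := ∃ F : Graph α β, IsFactor k F G

/-- The graph obtained from `G` by adding one new edge (called `none`) joining the vertices `x`
and `y` of `G`; it is a new loop if `x = y`. The old edges `e` are called `some e`. -/
def addEdge (G : Graph α β) (x y : α) (hx : x ∈ G.vertexSet) (hy : y ∈ G.vertexSet) :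
    Graph α (Option β) where
  vertexSet := G.vertexSet
  IsLink e u v := match e with
    | none => (u = x ∧ v = y) ∨ (u = y ∧ v = x)
    | some e => G.IsLink e u v
  isLink_symm := by
    rintro (_ | e) - <;> constructor <;> intro u v h
    · exact h.elim (fun h => .inr ⟨h.2, h.1⟩) (fun h => .inl ⟨h.2, h.1⟩)
    · exact IsLink.symm h
  eq_or_eq_of_isLink_of_isLink := by
    rintro (_ | e) a b c d h h'
    · rcases h with ⟨rfl, rfl⟩ | ⟨rfl, rfl⟩ <;> rcases h' with ⟨rfl, rfl⟩ | ⟨rfl, rfl⟩ <;> simp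
    · exact IsLink.left_eq_or_eq h h'
  left_mem_of_isLink := by
    rintro (_ | e) a b h
    · rcases h with ⟨rfl, rfl⟩ | ⟨rfl, rfl⟩ <;> assumption
    · exact IsLink.left_mem h

/-- `G` is maximal without a 2-factor within `M₂`: `G` belongs to `M₂` and has no 2-factor, and
whenever one new edge or loop is added so that the resulting graph is still in `M₂`, the
resulting graph has a 2-factor. -/
structure IsMaximalWithoutTwoFactor (G : Graph α β) : Prop where
  memM2 : G.MemM2
  not_hasFactor : ¬ G.HasFactor 2
  hasFactor_addEdge : ∀ x y (hx : x ∈ G.vertexSet) (hy : y ∈ G.vertexSet),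
    (G.addEdge x y hx hy).MemM2 → (G.addEdge x y hx hy).HasFactor 2

/-- `E(X, Y)`: the set of edges with one end in `X` and the other end in `Y`. -/
def edgesBetween (G : Graph α β) (X Y : Set α) : Set β :=
  {e | ∃ x ∈ X, ∃ y ∈ Y, G.IsLink e x y}

/-- `e(X, Y)`: the number of edges with one end in `X` and the other end in `Y`. -/
noncomputable def numEdgesBetween (G : Graph α β) (X Y : Set α) : ℕ :=
  (G.edgesBetween X Y).ncard

/-- No edge (and no loop) of `G` has both its ends in `X`. -/
def IsIndependent (G : Graph α β) (X : Set α) : Prop :=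
  ∀ x ∈ X, ∀ y ∈ X, ¬ G.Adj x y

/-- A set of edges of `G`, none of them a loop, no two of which share an end. -/
def IsMatching (G : Graph α β) (M : Set β) : Prop :=
  M ⊆ G.edgeSet ∧ (∀ e ∈ M, ∀ x, ¬ G.IsLoopAt e x) ∧
    ∀ e ∈ M, ∀ f ∈ M, ∀ x, G.Inc e x → G.Inc f x → e = f

/-- The vertex sets of the connected components of `G`: the classes of vertices reachable from
one another. -/
def components (G : Graph α β) : Set (Set α) :=
  {S | ∃ x ∈ G.vertexSet, S = {y | Relation.ReflTransGen G.Adj x y}}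

/-- Every vertex of `S` has exactly one loop, and any two distinct vertices of `S` are joined by
exactly two edges. -/
def IsDoublyComplete (G : Graph α β) (S : Set α) : Prop :=
  (∀ x ∈ S, (G.loopSet x).ncard = 1) ∧
    ∀ x ∈ S, ∀ y ∈ S, x ≠ y → (G.linkSet x y).ncard = 2

/-- The set `A` of vertices without loops. -/
def partA (G : Graph α β) : Set α := {x ∈ G.vertexSet | G.loopSet x = ∅}

/-- The set `B` of vertices with a loop that are joined to all other vertices by two edges. -/
def partB (G : Graph α β) : Set α :=
  {x ∈ G.vertexSet | (G.loopSet x).Nonempty ∧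
    ∀ y ∈ G.vertexSet, y ≠ x → (G.linkSet x y).ncard = 2}

/-- The set `C` of the remaining vertices. -/
def partC (G : Graph α β) : Set α := G.vertexSet \ (G.partA ∪ G.partB)

/-- The (vertex sets of the) connected components of the induced subgraph `G[C]`. -/
def componentsC (G : Graph α β) : Set (Set α) := (G.induce G.partC).components

end Graph

/-! A graph in the class is encoded by its symmetric matrix of multiplicities, and the proof rests
on Tutte's criterion for 2-factors. A barrier consists of disjoint vertex sets `S`, `T` and a
labelling of the other vertices without edges between different labels, such that 2|T| plus the
number of labels sending an odd number of edges to `T` exceeds 2|S| plus the degree sum of `T` after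
deletion of `S`. A barrier excludes a 2-factor by counting (`IsBarrier.not_hasTwoFactor`).
Conversely, `exists_isBarrier` extracts a barrier with independent `T` from Tutte's perfect matching
theorem, applied to a gadget graph.

Necessity (`IsMaximal.exists_conditions`): in a maximal graph, an edge whose addition would preserve
some barrier is already present with full multiplicity. Hence vertices of `S` are joined to
everything, label classes are complete and vertices outside `T` have loops; this leads to T = A and
S = B. Parity and the addition of a loop in `T` show that the excess of the barrier is exactly 2,
which is condition 4. If another condition failed, a new edge, or the transfer of vertices into `S`
or out of `T`, would leave a barrier that contradicts these facts.

Sufficiency (`Conditions.isMaximal`): the conditions make (B, A) a barrier. A new edge xy has no end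
in B and does not have both ends in one component. To complete xy to a 2-factor, omit one edge to A
at each component containing no end of xy; then every component meets an even number of ends of
chosen edges. Condition 5 yields Hall's condition for choosing the omissions so that no vertex of A
exceeds degree 2 (`Conditions.exists_omission`). Double edges to B fill the missing degrees in A,
where condition 4 is the required count, and the complete components are finished with loops and a
pairing (`Conditions.hasTwoFactor_of_selection`). -/

namespace SimpleGraph

/-! ### Tutte's perfect matching theorem, phrased with labellings -/

open Finset

variable {W : Type*} [Fintype W] [DecidableEq W]

/-- A labelling of the vertices outside `X` which is constant on the components of `H - X` and
has more than `|X|` label classes of odd size. -/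
structure IsOddLabelling (H : SimpleGraph W) (X : Finset W) (c : W → W) : Prop where
  eq_of_adj : ∀ a b, a ∉ X → b ∉ X → H.Adj a b → c a = c b
  card_lt : #X < #{l | Odd #{a ∈ Xᶜ | c a = l}}

/-- Representatives of the components serve as labels. With labels in place of components, classes
can be merged by redefining a function, without computing components again. -/
theorem IsTutteViolator.exists_isOddLabelling {H : SimpleGraph W} {u : Set W}
    (h : H.IsTutteViolator u) : ∃ X c, H.IsOddLabelling X c := by
  classical
  set K := ((⊤ : H.Subgraph).deleteVerts u).coe with hK
  have hmem : ∀ a, a ∉ u → a ∈ ((⊤ : H.Subgraph).deleteVerts u).verts := by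
    intro a ha; simp [ha]
  let r : K.ConnectedComponent → W := fun C => C.out.1
  have hr : Function.Injective r := by
    intro C D hCD
    have h1 : C.out = D.out := Subtype.ext hCD
    rw [← Quot.out_eq C, ← Quot.out_eq D, h1]
  let c : W → W := fun a =>
    if ha : a ∈ u then a else r (K.connectedComponentMk ⟨a, hmem a ha⟩)
  refine ⟨u.toFinset, c, ⟨?_, ?_⟩⟩
  · intro a b ha hb hab
    simp only [Set.mem_toFinset] at ha hb
    simp only [c, ha, hb, dif_neg, not_false_eq_true]
    congr 1
    apply ConnectedComponent.sound
    apply Adj.reachable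
    simp [hK, ha, hb, hab]
  · rw [IsTutteViolator, Set.ncard_eq_toFinset_card'] at h
    refine h.trans_le ?_
    rw [← Set.ncard_image_of_injective _ hr, ← Set.ncard_coe_finset]
    apply Set.ncard_le_ncard _ (Set.toFinite _)
    rintro _ ⟨C, hC, rfl⟩
    have hC : Odd C.supp.ncard := hC
    simp only [coe_filter, mem_univ, true_and, Set.mem_ofPred_eq]
    convert hC using 1
    rw [← Set.ncard_image_of_injective _ Subtype.val_injective, ← Set.ncard_coe_finset]
    congr 1
    ext a
    simp only [coe_filter, mem_compl, Set.mem_toFinset, Set.mem_ofPred_eq, Set.mem_image,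
      ConnectedComponent.mem_supp_iff, c]
    constructor
    · rintro ⟨ha, hac⟩
      rw [dif_neg ha] at hac
      exact ⟨⟨a, hmem a ha⟩, hr hac, rfl⟩
    · rintro ⟨⟨b, hb⟩, hbC, rfl⟩
      have hb' : b ∉ u := by simpa using hb
      refine ⟨hb', ?_⟩
      rw [dif_neg hb']
      exact congrArg r hbC

/-- Moving a vertex out of `X` whose neighbours outside `X` carry at most two labels. -/
theorem IsOddLabelling.erase {H : SimpleGraph W} {X : Finset W} {c : W → W}
    (h : H.IsOddLabelling X c) {v : W} (hv : v ∈ X) {l₁ l₂ : W}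
    (hl : ∀ b, b ∉ X → H.Adj v b → c b = l₁ ∨ c b = l₂) :
    ∃ c', H.IsOddLabelling (X.erase v) c' := by
  -- The two classes and `v` become one class. Two odd classes and `v` make an odd class, so
  -- whatever the parities are, at most one odd class is lost, while `X` also loses one element.
  let c' : W → W := fun a => if a = v ∨ c a = l₂ then l₁ else c a
  refine ⟨c', ⟨?_, ?_⟩⟩
  · have key : ∀ b, b ∉ X → H.Adj v b → c' v = c' b := by
      intro b hb hvb
      rcases hl b hb hvb with h1 | h1 <;> simp [c', h1]
    intro a b ha hb hab
    rw [mem_erase, not_and_or, not_not] at ha hb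
    rcases ha with rfl | ha
    · rcases hb with rfl | hb
      · rfl
      · exact key b hb hab
    · rcases hb with rfl | hb
      · exact (key a ha hab.symm).symm
      · have h1 := h.eq_of_adj a b ha hb hab
        have hav : a ≠ v := fun e => ha (e ▸ hv)
        have hbv : b ≠ v := fun e => hb (e ▸ hv)
        simp [c', hav, hbv, h1]
  · have hX : (X.erase v)ᶜ = insert v Xᶜ := by
      ext a; simp only [mem_compl, mem_erase, mem_insert]; tauto
    have hvX : v ∉ Xᶜ := by simpa using hv
    set O : Finset W := {l | Odd #{a ∈ Xᶜ | c a = l}} with hO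
    set O' : Finset W := {l | Odd #{a ∈ (X.erase v)ᶜ | c' a = l}} with hO'
    have hne : ∀ a ∈ Xᶜ, a ≠ v := fun a ha e => hvX (e ▸ ha)
    have other : ∀ l ∈ O, l ≠ l₁ → l ≠ l₂ → l ∈ O' := by
      intro l hlO h1 h2
      simp only [hO, hO', mem_filter, mem_univ, true_and] at hlO ⊢
      convert hlO using 2
      ext a
      rw [hX]
      simp only [mem_filter, mem_insert, c']
      constructor
      · rintro ⟨rfl | ha, hal⟩
        · simp at hal; exact absurd hal.symm h1
        · refine ⟨ha, ?_⟩
          split_ifs at hal with h3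
          · exact absurd hal.symm h1
          · exact hal
      · rintro ⟨ha, hal⟩
        refine ⟨.inr ha, ?_⟩
        rw [if_neg]
        · exact hal
        · rintro (h3 | h3)
          · exact hne a ha h3
          · exact h2 (hal.symm.trans h3)
    have both : l₁ ≠ l₂ → l₁ ∈ O → l₂ ∈ O → l₁ ∈ O' := by
      intro h12 h1 h2
      simp only [hO, hO', mem_filter, mem_univ, true_and] at h1 h2 ⊢
      have e : {a ∈ (X.erase v)ᶜ | c' a = l₁} =
          insert v ({a ∈ Xᶜ | c a = l₁} ∪ {a ∈ Xᶜ | c a = l₂}) := by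
        ext a
        rw [hX]
        simp only [mem_filter, mem_insert, mem_union, c']
        by_cases hav : a = v
        · simp [hav]
        · by_cases hal : c a = l₂
          · simp only [hav, hal, or_true, if_true]; tauto
          · simp [hav, hal]
      rw [e, card_insert_of_notMem, card_union_of_disjoint]
      · exact (h1.add_odd h2).add_one
      · rw [disjoint_filter]
        intro a _ h3 h4
        exact h12 (h3.symm.trans h4)
      · simp only [mem_union, mem_filter]
        tauto
    have hsub : ∃ l, O.erase l ⊆ O' := by
      by_cases h2 : l₂ ∈ O
      · refine ⟨l₂, fun l hl => ?_⟩
        rw [mem_erase] at hl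
        by_cases h1 : l = l₁
        · rw [h1] at hl ⊢
          exact both hl.1 hl.2 h2
        · exact other l hl.2 h1 hl.1
      · refine ⟨l₁, fun l hl => ?_⟩
        rw [mem_erase] at hl
        exact other l hl.2 hl.1 (fun e => h2 (e ▸ hl.2))
    obtain ⟨l, hl⟩ := hsub
    have h1 := card_le_card hl
    have h2 := pred_card_le_card_erase (s := O) (a := l)
    have h3 := h.card_lt
    have h4 := card_erase_of_mem hv
    have h5 : 0 < #X := card_pos.2 ⟨v, hv⟩
    rw [← hO] at h3
    omega

/-- If `H` has no perfect matching, there is an odd labelling all of whose removed vertices have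
neighbours with at least three labels. -/
theorem exists_isOddLabelling_three_labels {H : SimpleGraph W}
    (h : ¬ ∃ M : Subgraph H, M.IsPerfectMatching) :
    ∃ X c, H.IsOddLabelling X c ∧
      ∀ v ∈ X, ∀ l₁ l₂, ∃ b, b ∉ X ∧ H.Adj v b ∧ c b ≠ l₁ ∧ c b ≠ l₂ := by
  rw [tutte] at h
  push Not at h
  obtain ⟨u, hu⟩ := h
  obtain ⟨X₀, c₀, h₀⟩ := hu.exists_isOddLabelling
  -- A set `X` of least size works: a vertex of `X` seeing at most two labels could be moved out.
  have hex : ∃ n, ∃ X c, H.IsOddLabelling X c ∧ #X = n := ⟨_, X₀, c₀, h₀, rfl⟩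
  classical
  obtain ⟨X, c, hXc, hcard⟩ := Nat.find_spec hex
  refine ⟨X, c, hXc, fun v hv l₁ l₂ => ?_⟩
  by_contra hcon
  push Not at hcon
  obtain ⟨c', hc'⟩ := hXc.erase hv (l₁ := l₁) (l₂ := l₂) (by
    intro b hb hvb
    by_contra hne
    rw [not_or] at hne
    exact hne.2 (hcon b hb hvb hne.1))
  have := Nat.find_min' hex ⟨_, c', hc', rfl⟩
  have := card_erase_lt_of_mem hv
  omega

end SimpleGraph

/-! ### Multiplicity matrices, and the gadget turning perfect matchings into 2-factors -/

namespace MultMatrix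

open Finset

variable {V : Type*}

/-- The half-edges of the non-loops. -/
abbrev Dart (w : V → V → ℕ) : Type _ :=
  {p : V × V × Fin 2 // p.1 ≠ p.2.1 ∧ p.2.2.val < w p.1 p.2.1}

namespace Dart

variable {w : V → V → ℕ}

abbrev src (d : Dart w) : V := d.1.1

abbrev tgt (d : Dart w) : V := d.1.2.1

/-- The other half of the edge. -/
def opp (hw : ∀ u v, w u v = w v u) (d : Dart w) : Dart w :=
  ⟨(d.tgt, d.src, d.1.2.2), d.2.1.symm, by
    have h := d.2.2
    rw [hw] at h
    exact h⟩

theorem opp_opp (hw : ∀ u v, w u v = w v u) (d : Dart w) : (d.opp hw).opp hw = d := rfl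

theorem opp_ne (hw : ∀ u v, w u v = w v u) (d : Dart w) : d.opp hw ≠ d := by
  intro h
  exact d.2.1.symm (congrArg src h)

end Dart

variable [Fintype V] [DecidableEq V]

/-- A multigraph is given by the multiplicities `w u v` of its edges. A 2-factor is a
symmetric choice of smaller multiplicities; loops count twice in the degree. -/
def HasTwoFactor (w : V → V → ℕ) : Prop :=
  ∃ m : V → V → ℕ, (∀ u v, m u v = m v u) ∧ (∀ u v, m u v ≤ w u v) ∧
    ∀ u, ∑ v, m u v + m u u = 2

/-- The edges counted by `w` between `T` and the vertices outside `S ∪ T` with label `l`. -/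
def labelCount {ι : Type*} [DecidableEq ι] (w : V → V → ℕ) (S T : Finset V) (c : V → ι) (l : ι) :
    ℕ :=
  ∑ t ∈ T, ∑ u ∈ (S ∪ T)ᶜ with c u = l, w t u

/-- The labels outside `S ∪ T` whose class sends an odd number of edges to `T`. -/
def oddLabels {ι : Type*} [DecidableEq ι] (w : V → V → ℕ) (S T : Finset V) (c : V → ι) :
    Finset ι :=
  {l ∈ (S ∪ T)ᶜ.image c | Odd (labelCount w S T c l)}

/-- The sum over `T` of the degrees in the multigraph without `S`. -/
def degreeSum (w : V → V → ℕ) (S T : Finset V) : ℕ :=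
  ∑ t ∈ T, (∑ v ∈ Sᶜ, w t v + w t t)

/-- The obstruction to a 2-factor given by disjoint sets `S` and `T` and a labelling `c` of the
remaining vertices that is constant on components. -/
structure IsBarrier {ι : Type*} [DecidableEq ι] (w : V → V → ℕ) (S T : Finset V) (c : V → ι) :
    Prop where
  disjoint : Disjoint S T
  eq_zero : ∀ u v, u ∉ S → u ∉ T → v ∉ S → v ∉ T → c u ≠ c v → w u v = 0
  lt : 2 * #S + degreeSum w S T < 2 * #T + #(oddLabels w S T c)

theorem mem_oddLabels {ι : Type*} [DecidableEq ι] {w : V → V → ℕ} {S T : Finset V} {c : V → ι}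
    {l : ι} : l ∈ oddLabels w S T c ↔ Odd (labelCount w S T c l) := by
  rw [oddLabels, mem_filter, and_iff_right_iff_imp]
  intro h
  have h0 : labelCount w S T c l ≠ 0 := fun e => by simp [e] at h
  obtain ⟨t, -, ht⟩ := exists_ne_zero_of_sum_ne_zero h0
  obtain ⟨u, hu, -⟩ := exists_ne_zero_of_sum_ne_zero ht
  rw [mem_filter] at hu
  exact mem_image.2 ⟨u, hu.1, hu.2⟩

namespace Dart

variable {w : V → V → ℕ}

/-- Darts have distinct ends and an index in `Fin 2`, so the count needs multiplicities at most 2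
off the diagonal and vanishing diagonal terms on `P ∩ Q`. -/
theorem card_filter_mem (hw2 : ∀ u v, u ≠ v → w u v ≤ 2) (P Q : Finset V)
    (hPQ : ∀ u ∈ P, u ∈ Q → w u u = 0) :
    #{d : Dart w | d.src ∈ P ∧ d.tgt ∈ Q} = ∑ u ∈ P, ∑ v ∈ Q, w u v := by
  have h1 : #{d : Dart w | d.src ∈ P ∧ d.tgt ∈ Q} =
      #{p ∈ P ×ˢ Q ×ˢ (univ : Finset (Fin 2)) | p.1 ≠ p.2.1 ∧ p.2.2.val < w p.1 p.2.1} := by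
    rw [← card_map (Function.Embedding.subtype _)]
    congr 1
    ext p
    simp only [mem_map, mem_filter, mem_univ, true_and, Function.Embedding.subtype_apply,
      mem_product, and_true]
    constructor
    · rintro ⟨d, hd, rfl⟩
      exact ⟨hd, d.2⟩
    · rintro ⟨h, h'⟩
      exact ⟨⟨p, h'⟩, h, rfl⟩
  rw [h1, card_filter, sum_product]
  refine sum_congr rfl fun u hu => ?_
  rw [sum_product]
  refine sum_congr rfl fun v hv => ?_
  dsimp only
  by_cases huv : u = v
  · subst huv
    simp [hPQ u hu hv]
  · have h2 := hw2 u v huv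
    simp only [Fin.sum_univ_two, huv, ne_eq, not_false_eq_true, true_and]
    interval_cases w u v <;> simp

end Dart

/-- Two copies of every vertex, adjacent if the vertex has a loop, and the two halves of every
non-loop edge, adjacent to one another and to the copies of their end. -/
def gadget (w : V → V → ℕ) (hw : ∀ u v, w u v = w v u) :
    SimpleGraph ((V × Bool) ⊕ Dart w) where
  Adj
    | .inl p, .inl q => p.1 = q.1 ∧ p.2 ≠ q.2 ∧ w p.1 p.1 ≠ 0
    | .inl p, .inr d => d.src = p.1
    | .inr d, .inl p => d.src = p.1
    | .inr d, .inr d' => d' = d.opp hw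
  symm := ⟨by
    rintro (p | d) (q | d') h
    · exact ⟨h.1.symm, h.2.1.symm, h.1 ▸ h.2.2⟩
    · exact h
    · exact h
    · have h : d' = d.opp hw := h
      change d = d'.opp hw
      rw [h, Dart.opp_opp]⟩
  loopless := ⟨by
    rintro (p | d) h
    · exact h.2.1 rfl
    · exact (Dart.opp_ne hw d) h.symm⟩

/-- Here `f` sends each gadget vertex to its partner in the matching. An edge whose two halves are
partners is discarded; otherwise each half is matched to a copy of its own end. The two copies of a
vertex are therefore matched to each other, giving a loop, or to two different used darts; either
way the degree is 2. -/
theorem hasTwoFactor_of_involution {w : V → V → ℕ} (hw : ∀ u v, w u v = w v u)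
    (hw2 : ∀ u v, u ≠ v → w u v ≤ 2) (f : (V × Bool) ⊕ Dart w → (V × Bool) ⊕ Dart w)
    (hff : ∀ a, f (f a) = a) (hf : ∀ a, (gadget w hw).Adj a (f a)) : HasTwoFactor w := by
  classical
  let used : Dart w → Prop := fun d => f (.inr d) ≠ .inr (d.opp hw)
  have used_opp : ∀ d, used (d.opp hw) ↔ used d := by
    intro d
    simp only [used, ne_eq, Dart.opp_opp, not_iff_not]
    constructor <;> intro h <;> rw [← h, hff]
  have hused : ∀ d, used d ↔ ∃ i, f (.inr d) = .inl (d.src, i) := by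
    intro d
    have h1 := hf (.inr d)
    rcases h2 : f (.inr d) with ⟨u, i⟩ | d'
    · rw [h2] at h1
      have h1 : d.src = u := h1
      subst h1
      simp [used, h2]
    · rw [h2] at h1
      have h1 : d' = d.opp hw := h1
      simp [used, h2, h1]
  let m : V → V → ℕ := fun u v =>
    if u = v then (if f (.inl (u, false)) = .inl (u, true) then 1 else 0)
    else #{d : Dart w | d.src = u ∧ d.tgt = v ∧ used d}
  refine ⟨m, ?_, ?_, ?_⟩
  · intro u v
    by_cases huv : u = v
    · rw [huv]
    · simp only [m, huv, Ne.symm huv, if_false]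
      refine card_bij' (fun d _ => d.opp hw) (fun d _ => d.opp hw) ?_ ?_ ?_ ?_
      · intro d hd
        simp only [mem_filter, mem_univ, true_and, used_opp] at hd ⊢
        exact ⟨hd.2.1, hd.1, hd.2.2⟩
      · intro d hd
        simp only [mem_filter, mem_univ, true_and, used_opp] at hd ⊢
        exact ⟨hd.2.1, hd.1, hd.2.2⟩
      · intros; rfl
      · intros; rfl
  · intro u v
    by_cases huv : u = v
    · subst huv
      simp only [m, if_true]
      split_ifs with h
      · have h1 := hf (.inl (u, false))
        rw [h] at h1
        exact Nat.one_le_iff_ne_zero.2 h1.2.2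
      · exact Nat.zero_le _
    · simp only [m, huv, if_false]
      have h1 := Dart.card_filter_mem hw2 {u} {v} (by simp [huv])
      rw [sum_singleton, sum_singleton] at h1
      simp only [mem_singleton] at h1
      rw [← h1]
      apply card_le_card
      intro d hd
      simp only [mem_filter, mem_univ, true_and] at hd ⊢
      exact ⟨hd.1, hd.2.1⟩
  · intro u
    have h1 : ∑ v, m u v = #{d : Dart w | d.src = u ∧ used d} + m u u := by
      rw [← add_sum_erase _ _ (mem_univ u), add_comm]
      congr 1
      rw [card_eq_sum_card_fiberwise (f := Dart.tgt) (t := univ.erase u)]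
      · refine sum_congr rfl fun v hv => ?_
        have hv := (mem_erase.1 hv).1
        simp only [m, hv.symm, if_false, filter_filter]
        congr 1
        ext d
        simp only [mem_filter, mem_univ, true_and]
        tauto
      · intro d hd
        simp only [coe_filter, mem_univ, true_and, Set.mem_ofPred_eq] at hd
        rw [mem_coe, mem_erase]
        exact ⟨fun h => d.2.1 (hd.1.trans h.symm), mem_univ _⟩
    rw [h1]
    simp only [m, if_true]
    by_cases hl : f (.inl (u, false)) = .inl (u, true)
    · have hl' : f (.inl (u, true)) = .inl (u, false) := by rw [← hl, hff]
      have h2 : #{d : Dart w | d.src = u ∧ used d} = 0 := by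
        rw [card_eq_zero, filter_eq_empty_iff]
        rintro d - ⟨hd, hd'⟩
        obtain ⟨i, hi⟩ := (hused d).1 hd'
        have h3 : f (.inl (u, i)) = .inr d := by rw [← hd, ← hi, hff]
        cases i
        · rw [hl] at h3; cases h3
        · rw [hl'] at h3; cases h3
      rw [h2, if_pos hl]
    · rw [if_neg hl]
      have hex : ∀ i, ∃ d : Dart w, f (.inl (u, i)) = .inr d ∧ d.src = u := by
        intro i
        have h2 := hf (.inl (u, i))
        rcases h3 : f (.inl (u, i)) with ⟨v, j⟩ | d
        · rw [h3] at h2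
          obtain ⟨h4, h5, -⟩ := h2
          dsimp only at h4 h5
          subst h4
          exfalso
          apply hl
          cases i <;> cases j <;> simp at h5
          · exact h3
          · rw [← h3, hff]
        · rw [h3] at h2
          exact ⟨d, rfl, h2⟩
      choose d hd hdu using hex
      have hne : d false ≠ d true := by
        intro h
        have h2 : f (.inl (u, false)) = f (.inl (u, true)) := by rw [hd, hd, h]
        have h3 := congrArg f h2
        rw [hff, hff] at h3
        simp at h3
      have hset : ({x : Dart w | x.src = u ∧ used x} : Finset (Dart w)) = {d false, d true} := by
        ext x
        simp only [mem_filter, mem_univ, true_and, mem_insert, mem_singleton]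
        constructor
        · rintro ⟨hx, hx'⟩
          obtain ⟨i, hi⟩ := (hused x).1 hx'
          have h3 : f (.inl (u, i)) = .inr x := by rw [← hx, ← hi, hff]
          rw [hd i] at h3
          have h4 : d i = x := Sum.inr_injective h3
          cases i
          · exact .inl h4.symm
          · exact .inr h4.symm
        · have h3 : ∀ i, (d i).src = u ∧ used (d i) := by
            intro i
            refine ⟨hdu i, (hused _).2 ⟨i, ?_⟩⟩
            rw [hdu i, ← hd i, hff]
          rintro (rfl | rfl) <;> exact h3 _
      rw [hset, card_pair hne]

theorem hasTwoFactor_of_isPerfectMatching {w : V → V → ℕ} (hw : ∀ u v, w u v = w v u)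
    (hw2 : ∀ u v, u ≠ v → w u v ≤ 2) {M : (gadget w hw).Subgraph} (hM : M.IsPerfectMatching) :
    HasTwoFactor w := by
  have h := fun a => hM.1 (hM.2 a)
  choose f hf hf' using h
  exact hasTwoFactor_of_involution hw hw2 f (fun a => (hf' _ _ (hf a).symm).symm)
    fun a => (hf a).adj_sub

end MultMatrix

/-! ### From a Tutte labelling of the gadget to a barrier -/

namespace MultMatrix

open Finset

variable {V : Type*} [Fintype V] [DecidableEq V]

-- For a labelling in which every vertex of `X` sees at least three labels, `S` collects the
-- vertices with copies in `X`, and `T` those whose copies lie outside `X` with different labels.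
-- Then `X` consists of the copies of `S` and the darts leaving `T`, and the odd label classes can
-- be counted.
set_option maxHeartbeats 1000000 in
theorem exists_isBarrier {w : V → V → ℕ} (hw : ∀ u v, w u v = w v u)
    (hw2 : ∀ u v, u ≠ v → w u v ≤ 2) (h : ¬ HasTwoFactor w) :
    ∃ (S T : Finset V) (c : V → (V × Bool) ⊕ Dart w), IsBarrier w S T c ∧
      ∀ u ∈ T, ∀ v ∈ T, w u v = 0 := by
  classical
  obtain ⟨X, c, hXc, h3⟩ := SimpleGraph.exists_isOddLabelling_three_labels (H := gadget w hw)
    fun ⟨M, hM⟩ => h (hasTwoFactor_of_isPerfectMatching hw hw2 hM)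
  have hlab : ∀ (d : Dart w) i, .inr d ∉ X → .inl (d.src, i) ∉ X →
      c (.inr d) = c (.inl (d.src, i)) := fun d i h1 h2 =>
    hXc.eq_of_adj _ _ h1 h2 (by change d.src = d.src; rfl)
  have hlabo : ∀ d : Dart w, .inr d ∉ X → .inr (d.opp hw) ∉ X →
      c (.inr d) = c (.inr (d.opp hw)) := fun d h1 h2 =>
    hXc.eq_of_adj _ _ h1 h2 (by change d.opp hw = d.opp hw; rfl)
  let S : Finset V := {u | .inl (u, false) ∈ X}
  let T : Finset V := {u | .inl (u, false) ∉ X ∧ c (.inl (u, false)) ≠ c (.inl (u, true))}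
  -- If only one copy were in `X`, all its neighbours outside `X` would have the label of the other
  -- copy.
  have hcopy : ∀ u i j, .inl (u, i) ∈ X → .inl (u, j) ∈ X := by
    intro u i j hi
    by_contra hj
    obtain ⟨b, hb, hab, hne, -⟩ := h3 _ hi (c (.inl (u, j))) (c (.inl (u, j)))
    rcases b with ⟨v, k⟩ | d
    · obtain ⟨h4, h5, -⟩ := hab
      dsimp only at h4 h5
      subst h4
      have hij : i ≠ j := fun e => hj (e ▸ hi)
      have hk : k = j :=
        (by decide : ∀ i j k : Bool, i ≠ j → i ≠ k → k = j) i j k hij h5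
      exact hne (by rw [hk])
    · have h4 : d.src = u := hab
      subst h4
      exact hne (hlab d j hb hj)
  have hS : ∀ u i, .inl (u, i) ∈ X ↔ u ∈ S := by
    intro u i
    simp only [S, mem_filter, mem_univ, true_and]
    exact ⟨hcopy u i false, hcopy u false i⟩
  have hT : ∀ u, u ∈ T ↔ u ∉ S ∧ c (.inl (u, false)) ≠ c (.inl (u, true)) := by
    intro u; simp [T, S]
  have hdisj : Disjoint S T := by
    rw [disjoint_left]
    intro u hu hu'
    exact ((hT u).1 hu').1 hu
  have hU : ∀ u i, u ∉ S → u ∉ T → c (.inl (u, i)) = c (.inl (u, false)) := by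
    intro u i hu hu'
    rw [hT] at hu'
    cases i
    · rfl
    · by_contra hne
      exact hu' ⟨hu, fun e => hne e.symm⟩
  have hTX : ∀ d : Dart w, d.src ∈ T → .inr d ∈ X := by
    intro d hd
    by_contra hdX
    obtain ⟨h4, h5⟩ := (hT _).1 hd
    apply h5
    rw [← hlab d false hdX, ← hlab d true hdX]
    · rwa [hS]
    · rwa [hS]
  -- A dart has only three neighbours: the copies of its source and its opposite. To show three
  -- labels, all must lie outside `X` and have distinct labels.
  have hXT : ∀ d : Dart w, .inr d ∈ X → d.src ∈ T ∧ .inr (d.opp hw) ∉ X := by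
    intro d hd
    constructor
    · obtain ⟨b, hb, hab, hne1, hne2⟩ := h3 _ hd (c (.inl (d.src, false))) (c (.inr (d.opp hw)))
      rcases b with ⟨v, k⟩ | d'
      · have h4 : d.src = v := hab
        subst h4
        have h5 : d.src ∉ S := by rwa [hS] at hb
        refine (hT _).2 ⟨h5, ?_⟩
        cases k
        · exact absurd rfl hne1
        · exact hne1.symm
      · have h4 : d' = d.opp hw := hab
        exact absurd (by rw [h4]) hne2
    · obtain ⟨b, hb, hab, hne1, hne2⟩ := h3 _ hd (c (.inl (d.src, false)))
        (c (.inl (d.src, true)))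
      rcases b with ⟨v, k⟩ | d'
      · have h4 : d.src = v := hab
        subst h4
        cases k
        · exact absurd rfl hne1
        · exact absurd rfl hne2
      · have h4 : d' = d.opp hw := hab
        rwa [← h4]
  have hTind : ∀ u ∈ T, ∀ v ∈ T, w u v = 0 := by
    intro u hu v hv
    by_contra h0
    by_cases huv : u = v
    · subst huv
      obtain ⟨h4, h5⟩ := (hT _).1 hu
      refine h5 (hXc.eq_of_adj _ _ ?_ ?_ ⟨rfl, by simp, h0⟩) <;> rwa [hS]
    · let d : Dart w := ⟨(u, v, 0), huv, Nat.pos_of_ne_zero h0⟩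
      exact (hXT d (hTX d hu)).2 (hTX (d.opp hw) hv)
  refine ⟨S, T, fun u => c (.inl (u, false)), ⟨hdisj, ?_, ?_⟩, hTind⟩
  · intro u v hu hu' hv hv' hne
    by_contra h0
    by_cases huv : u = v
    · exact hne (by rw [huv])
    · let d : Dart w := ⟨(u, v, 0), huv, Nat.pos_of_ne_zero h0⟩
      have h4 : .inr d ∉ X := fun e => hu' (hXT d e).1
      have h5 : .inr (d.opp hw) ∉ X := fun e => hv' (hXT _ e).1
      apply hne
      rw [← hlab d false h4 (by rwa [hS]), hlabo d h4 h5,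
        hlab (d.opp hw) false h5 (by rwa [hS])]
      rfl
  · set q := #(oddLabels w S T fun u => c (.inl (u, false))) with hq
    have hcardX : #X = 2 * #S + #{d : Dart w | d.src ∈ T} := by
      have h4 : X = (S ×ˢ (univ : Finset Bool)).disjSum {d : Dart w | d.src ∈ T} := by
        ext (⟨u, i⟩ | d)
        · simp [hS]
        · simp only [inr_mem_disjSum, mem_filter, mem_univ, true_and]
          exact ⟨fun e => (hXT d e).1, hTX d⟩
      rw [h4, card_disjSum, card_product]
      simp [mul_comm]
    -- The darts from `T` to `S` are counted in |X| but not in `degreeSum`. Their opposites, all of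
    -- whose neighbours are in `X`, contribute at most as many odd labels, so the two terms cancel
    -- in the end.
    have hdartT : #{d : Dart w | d.src ∈ T} =
        degreeSum w S T + #{d : Dart w | d.src ∈ S ∧ d.tgt ∈ T} := by
      have h4 := Dart.card_filter_mem hw2 T univ fun u hu _ => hTind u hu u hu
      have h5 := Dart.card_filter_mem hw2 S T fun u hu hu' => absurd hu' (disjoint_left.1 hdisj hu)
      simp only [mem_univ, and_true] at h4
      rw [sum_comm] at h5
      have h6 : ∑ t ∈ T, ∑ s ∈ S, w s t = ∑ t ∈ T, ∑ s ∈ S, w t s :=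
        sum_congr rfl fun t _ => sum_congr rfl fun u _ => hw u t
      rw [h6] at h5
      rw [h4, h5, degreeSum, ← sum_add_distrib]
      refine sum_congr rfl fun u hu => ?_
      rw [hTind u hu u hu, add_zero, sum_compl_add_sum]
    -- A class containing neither a copy of a vertex of `T` nor a dart from `S` to `T` consists of
    -- pairs of copies, of darts whose opposites are also outside `X` (an even number, paired by
    -- `opp`), and of darts into `T`. Its parity is thus that of `labelCount`.
    have hsub : ({l | Odd #{a ∈ Xᶜ | c a = l}} : Finset ((V × Bool) ⊕ Dart w)) ⊆
        ((T ×ˢ (univ : Finset Bool)).image (fun p => c (.inl p)) ∪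
          ({d : Dart w | d.src ∈ S ∧ d.tgt ∈ T} : Finset _).image (fun d => c (.inr d))) ∪
          oddLabels w S T fun u => c (.inl (u, false)) := by
      intro l hl
      rw [mem_filter] at hl
      by_contra hcon
      simp only [mem_union, not_or, mem_image, mem_product, mem_univ, and_true, mem_filter,
        true_and, not_exists, not_and, Prod.forall, mem_oddLabels] at hcon
      obtain ⟨⟨hc1, hc2⟩, hc3⟩ := hcon
      apply hc3
      let A : Finset V := {u ∈ (S ∪ T)ᶜ | c (.inl (u, false)) = l}
      have hA : ∀ u, u ∈ A ↔ (u ∉ S ∧ u ∉ T) ∧ c (.inl (u, false)) = l := by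
        intro u; simp [A]
      let Z₁ : Finset (Dart w) := {d | d.src ∈ A ∧ d.tgt ∈ T}
      let Z₂ : Finset (Dart w) := {d | .inr d ∉ X ∧ .inr (d.opp hw) ∉ X ∧ c (.inr d) = l}
      have hsplit : {a ∈ Xᶜ | c a = l} = (A ×ˢ (univ : Finset Bool)).disjSum (Z₁ ∪ Z₂) := by
        ext (⟨u, i⟩ | d)
        · simp only [mem_filter, mem_compl, hS, inl_mem_disjSum, mem_product, mem_univ, and_true,
            hA]
          constructor
          · rintro ⟨h4, h5⟩
            have h6 : u ∉ T := fun e => hc1 u i e h5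
            exact ⟨⟨h4, h6⟩, by rw [← hU u i h4 h6, h5]⟩
          · rintro ⟨⟨h4, h5⟩, h6⟩
            exact ⟨h4, by rw [hU u i h4 h5, h6]⟩
        · simp only [mem_filter, mem_compl, inr_mem_disjSum, mem_union, Z₁, Z₂, mem_univ,
            true_and, hA]
          constructor
          · rintro ⟨h4, h5⟩
            by_cases h6 : .inr (d.opp hw) ∈ X
            · have h7 : d.tgt ∈ T := (hXT _ h6).1
              have h8 : d.src ∉ T := fun e => h4 (hTX d e)
              have h9 : d.src ∉ S := fun e => hc2 d ⟨e, h7⟩ h5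
              exact .inl ⟨⟨⟨h9, h8⟩, by rw [← hlab d false h4 (by rwa [hS]), h5]⟩, h7⟩
            · exact .inr ⟨h4, h6, h5⟩
          · rintro (⟨⟨⟨h4, h5⟩, h6⟩, h7⟩ | ⟨h4, -, h5⟩)
            · have h8 : .inr d ∉ X := fun e => h5 (hXT d e).1
              exact ⟨h8, by rw [hlab d false h8 (by rwa [hS]), h6]⟩
            · exact ⟨h4, h5⟩
      have hZ : Disjoint Z₁ Z₂ := by
        rw [disjoint_left]
        intro d h4 h5
        simp only [Z₁, Z₂, mem_filter, mem_univ, true_and] at h4 h5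
        exact h5.2.1 (hTX (d.opp hw) h4.2)
      have hZ₂ : Even #Z₂ := by
        have h4 : ∑ d ∈ Z₂, (1 : ZMod 2) = 0 := by
          refine sum_involution (fun d _ => d.opp hw) ?_ ?_ ?_ ?_
          · intros; decide
          · intro d _ _
            exact Dart.opp_ne hw d
          · intro d hd
            simp only [Z₂, mem_filter, mem_univ, true_and, Dart.opp_opp] at hd ⊢
            exact ⟨hd.2.1, hd.1, by rw [← hlabo d hd.1 hd.2.1, hd.2.2]⟩
          · intros; rfl
        rw [sum_const, nsmul_eq_mul, mul_one] at h4
        exact (ZMod.natCast_eq_zero_iff_even).1 h4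
      have hZ₁ : #Z₁ = labelCount w S T (fun u => c (.inl (u, false))) l := by
        refine (Dart.card_filter_mem hw2 A T fun u hu hu' => absurd hu' ((hA u).1 hu).1.2).trans ?_
        rw [sum_comm, labelCount]
        exact sum_congr rfl fun t _ => sum_congr rfl fun u _ => hw u t
      have h5 := hl.2
      rw [hsplit, card_disjSum, card_union_of_disjoint hZ, card_product, hZ₁] at h5
      rw [Nat.odd_iff] at h5 ⊢
      rw [Nat.even_iff] at hZ₂
      simp only [card_univ, Fintype.card_bool] at h5
      omega
    have h4 := card_le_card hsub
    have h5 := hXc.card_lt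
    have h6 := (card_union_le _ _).trans (Nat.add_le_add_right (card_union_le
      ((T ×ˢ (univ : Finset Bool)).image (fun p => c (.inl p)))
      (({d : Dart w | d.src ∈ S ∧ d.tgt ∈ T} : Finset _).image (fun d => c (.inr d))))
      #(oddLabels w S T fun u => c (.inl (u, false))))
    have h7 : #((T ×ˢ (univ : Finset Bool)).image (fun p => c (.inl p))) ≤ 2 * #T := by
      refine card_image_le.trans ?_
      rw [card_product, card_univ, Fintype.card_bool, mul_comm]
    have h8 : #(({d : Dart w | d.src ∈ S ∧ d.tgt ∈ T} : Finset _).image (fun d => c (.inr d))) ≤ _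
      := card_image_le
    omega

end MultMatrix

/-! ### Barriers exclude 2-factors, and their stability under adding edges -/

namespace MultMatrix

open Finset

variable {V : Type*} {ι : Type*} [DecidableEq ι]

theorem sum_labels (U : Finset V) (c : V → ι) (f : V → ℕ) :
    ∑ u ∈ U, f u = ∑ l ∈ U.image c, ∑ u ∈ U with c u = l, f u :=
  (sum_fiberwise_of_maps_to (fun _ hu => mem_image_of_mem c hu) f).symm

variable [DecidableEq V]

/-- Handshake lemma: off-diagonal entries occur in equal pairs, and each diagonal entry occurs in
both sums. -/
theorem even_sum_add_sum_diag {m : V → V → ℕ} (hm : ∀ u v, m u v = m v u) (K : Finset V) :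
    Even (∑ u ∈ K, ∑ v ∈ K, m u v + ∑ u ∈ K, m u u) := by
  induction K using Finset.induction_on with
  | empty => simp
  | insert a s ha ih =>
    have h1 : ∑ u ∈ s, m u a = ∑ v ∈ s, m a v := sum_congr rfl fun u _ => hm u a
    simp only [sum_insert ha, sum_add_distrib]
    rw [h1]
    rw [Nat.even_iff] at ih ⊢
    omega

/-- The multiplicities after adding one edge joining `x` and `y`. -/
def addOne (w : V → V → ℕ) (x y u v : V) : ℕ :=
  w u v + if (u = x ∧ v = y) ∨ (u = y ∧ v = x) then 1 else 0

theorem addOne_eq {w : V → V → ℕ} {x y u v : V} (h : ¬ ((u = x ∧ v = y) ∨ (u = y ∧ v = x))) :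
    addOne w x y u v = w u v := by
  rw [addOne, if_neg h, add_zero]

variable [Fintype V]

theorem sum_split {S T : Finset V} (h : Disjoint S T) (f : V → ℕ) :
    ∑ v, f v = ∑ v ∈ S, f v + ∑ v ∈ T, f v + ∑ v ∈ (S ∪ T)ᶜ, f v := by
  rw [← sum_union h, sum_add_sum_compl]

theorem sum_compl_split {S T : Finset V} (h : Disjoint S T) (f : V → ℕ) :
    ∑ v ∈ Sᶜ, f v = ∑ v ∈ T, f v + ∑ v ∈ (S ∪ T)ᶜ, f v := by
  have h1 := sum_split h f
  have h2 := sum_add_sum_compl S f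
  omega

theorem sum_labelCount (w : V → V → ℕ) (S T : Finset V) (c : V → ι) :
    ∑ t ∈ T, ∑ u ∈ (S ∪ T)ᶜ, w t u = ∑ l ∈ (S ∪ T)ᶜ.image c, labelCount w S T c l := by
  simp only [labelCount]
  refine Eq.trans ?_ sum_comm
  exact sum_congr rfl fun t _ => sum_labels _ c _

theorem degreeSum_of_independent {w : V → V → ℕ} {S T : Finset V} (h : Disjoint S T)
    (hT : ∀ u ∈ T, ∀ v ∈ T, w u v = 0) :
    degreeSum w S T = ∑ t ∈ T, ∑ u ∈ (S ∪ T)ᶜ, w t u := by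
  refine sum_congr rfl fun t ht => ?_
  rw [sum_compl_split h, sum_eq_zero (hT t ht), hT t ht t ht, zero_add, add_zero]

/-- Count the edges of a 2-factor at `T`. What they cannot obtain from the edges outside `S` must
come from `S`, whose total degree is only 2|S|, and every odd class wastes one edge. -/
theorem IsBarrier.not_hasTwoFactor {w : V → V → ℕ} {S T : Finset V} {c : V → ι}
    (h : IsBarrier w S T c) : ¬ HasTwoFactor w := by
  rintro ⟨m, hm, hmw, hdeg⟩
  have hST := h.disjoint
  set U := (S ∪ T)ᶜ with hU
  -- An odd class omits an edge to `T` or uses an edge to `S`: otherwise its degree sum 2|K| would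
  -- be an odd number plus the even degree sum inside the class.
  have hlabel : ∀ l ∈ U.image c, (∑ t ∈ T, ∑ u ∈ U with c u = l, m t u) +
      (if Odd (labelCount w S T c l) then 1 else 0) ≤
      labelCount w S T c l + ∑ s ∈ S, ∑ u ∈ U with c u = l, m s u := by
    intro l _
    have hle : ∑ t ∈ T, ∑ u ∈ U with c u = l, m t u ≤ labelCount w S T c l :=
      sum_le_sum fun t _ => sum_le_sum fun u _ => hmw t u
    split_ifs with hodd
    · by_contra hcon
      set K := U.filter (c · = l) with hK
      have h1 : ∑ s ∈ S, ∑ u ∈ K, m s u = 0 := by omega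
      have h2 : ∑ t ∈ T, ∑ u ∈ K, m t u = labelCount w S T c l := by omega
      have h3 : ∑ u ∈ K, (∑ v, m u v + m u u) = 2 * #K := by
        rw [sum_congr rfl fun u _ => hdeg u]; simp [mul_comm]
      have h4 : ∀ u ∈ K, ∑ v ∈ U, m u v = ∑ v ∈ K, m u v := by
        intro u hu
        refine (sum_subset (filter_subset _ _) fun v hv hv' => ?_).symm
        rw [mem_filter, not_and] at hv'
        rw [hK, mem_filter] at hu
        have h5 := hv' hv
        have hu1 := hu.1
        rw [hU, mem_compl, mem_union, not_or] at hv hu1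
        have h6 := h.eq_zero u v hu1.1 hu1.2 hv.1 hv.2 fun e => h5 (e ▸ hu.2)
        have := hmw u v
        omega
      have h5 : ∑ u ∈ K, (∑ v, m u v + m u u) = ∑ s ∈ S, ∑ u ∈ K, m s u +
          ∑ t ∈ T, ∑ u ∈ K, m t u + (∑ u ∈ K, ∑ v ∈ K, m u v + ∑ u ∈ K, m u u) := by
        rw [sum_comm (s := S), sum_comm (s := T), ← sum_add_distrib, ← sum_add_distrib,
          ← sum_add_distrib]
        refine sum_congr rfl fun u hu => ?_
        rw [sum_split hST, h4 u hu, sum_congr rfl fun v _ => hm u v,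
          sum_congr (s₁ := T) rfl fun v _ => hm u v]
        omega
      have h6 := even_sum_add_sum_diag hm K
      rw [Nat.even_iff] at h6
      rw [Nat.odd_iff] at hodd
      omega
    · omega
  have hsum := sum_le_sum hlabel
  rw [sum_add_distrib, sum_add_distrib, ← card_filter, sum_comm, sum_comm (t := S)] at hsum
  have e1 : ∑ t ∈ T, ∑ l ∈ U.image c, ∑ u ∈ U with c u = l, m t u = ∑ t ∈ T, ∑ u ∈ U, m t u :=
    sum_congr rfl fun t _ => (sum_labels U c _).symm
  have e2 : ∑ t ∈ S, ∑ l ∈ U.image c, ∑ u ∈ U with c u = l, m t u = ∑ t ∈ S, ∑ u ∈ U, m t u :=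
    sum_congr rfl fun t _ => (sum_labels U c _).symm
  rw [e1, e2, ← sum_labelCount, ← hU] at hsum
  have hTdeg : 2 * #T = ∑ t ∈ T, ∑ s ∈ S, m t s + ∑ t ∈ T, ∑ v ∈ T, m t v +
      ∑ t ∈ T, ∑ u ∈ U, m t u + ∑ t ∈ T, m t t := by
    rw [← sum_add_distrib, ← sum_add_distrib, ← sum_add_distrib,
      sum_congr rfl fun t _ => (congrArg (· + m t t) (sum_split hST (m t))).symm.trans (hdeg t)]
    simp [mul_comm]
  have hSdeg : ∑ s ∈ S, ∑ t ∈ T, m s t + ∑ s ∈ S, ∑ u ∈ U, m s u ≤ 2 * #S := by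
    rw [← sum_add_distrib]
    calc _ ≤ ∑ s ∈ S, 2 := sum_le_sum fun s _ => by
          have h1 := hdeg s
          rw [sum_split hST, ← hU] at h1
          omega
      _ = _ := by simp [mul_comm]
  have hTS : ∑ t ∈ T, ∑ s ∈ S, m t s = ∑ s ∈ S, ∑ t ∈ T, m s t := by
    rw [sum_comm]
    exact sum_congr rfl fun s _ => sum_congr rfl fun t _ => hm t s
  have hD : degreeSum w S T = ∑ t ∈ T, ∑ v ∈ T, w t v + ∑ t ∈ T, ∑ u ∈ U, w t u +
      ∑ t ∈ T, w t t := by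
    rw [← sum_add_distrib, ← sum_add_distrib]
    exact sum_congr rfl fun t _ => by rw [sum_compl_split hST]
  have h1 : ∑ t ∈ T, ∑ v ∈ T, m t v ≤ ∑ t ∈ T, ∑ v ∈ T, w t v :=
    sum_le_sum fun t _ => sum_le_sum fun v _ => hmw t v
  have h2 : ∑ t ∈ T, m t t ≤ ∑ t ∈ T, w t t := sum_le_sum fun t _ => hmw t t
  have h3 := h.lt
  rw [hD, oddLabels, ← hU] at h3
  omega

/-- There is no 2-factor, but every addition of an edge within the class of multigraphs with at
most two parallel edges and at most one loop at every vertex creates one. -/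
structure IsMaximal (w : V → V → ℕ) : Prop where
  not_hasTwoFactor : ¬ HasTwoFactor w
  hasTwoFactor_addOne : ∀ x y, w x y < (if x = y then 1 else 2) → HasTwoFactor (addOne w x y)

/-- The vertices without a loop. -/
def setA (w : V → V → ℕ) : Finset V := {u | w u u = 0}

theorem mem_setA {V : Type*} [Fintype V] {w : V → V → ℕ} {u : V} : u ∈ setA w ↔ w u u = 0 := by
  simp [setA]

/-- The vertices with a loop which are joined to all other vertices by two edges. -/
def setB (w : V → V → ℕ) : Finset V := {u | w u u ≠ 0 ∧ ∀ v, v ≠ u → w u v = 2}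

/-- The remaining vertices. -/
def setC (w : V → V → ℕ) : Finset V := (setB w ∪ setA w)ᶜ

/-- The conditions of the theorem, for a labelling `c` of the components of the graph on
`setC w`. -/
structure Conditions (w : V → V → ℕ) (c : V → ι) : Prop where
  independent : ∀ u ∈ setA w, ∀ v ∈ setA w, w u v = 0
  eq_zero : ∀ u ∈ setC w, ∀ v ∈ setC w, c u ≠ c v → w u v = 0
  eq_two : ∀ u ∈ setC w, ∀ v ∈ setC w, u ≠ v → c u = c v → w u v = 2
  left_le_one : ∀ a ∈ setA w, ∀ l, ∑ u ∈ setC w with c u = l, w a u ≤ 1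
  right_le_one : ∀ u ∈ setC w, ∑ a ∈ setA w, w a u ≤ 1
  odd : ∀ u ∈ setC w, Odd (labelCount w (setB w) (setA w) c (c u))
  card_eq : 2 * #(setA w) + #((setC w).image c) =
    2 * #(setB w) + ∑ a ∈ setA w, ∑ u ∈ setC w, w a u + 2
  surplus : ∀ A' ⊆ setA w, A'.Nonempty → ∀ L' ⊆ (setC w).image c,
    2 + ∑ l ∈ L', ∑ a ∈ A', ∑ u ∈ setC w with c u = l, w a u ≤ 2 * #A' + #L'

/-- The barrier inequality sees only the edges from `T` to vertices outside `S`, and the labelling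
condition only pairs with different labels. Edges at `S` or inside a label class may therefore be
added freely. -/
theorem IsBarrier.congr {w w' : V → V → ℕ} {S T : Finset V} {c : V → ι} (h : IsBarrier w S T c)
    (hT : ∀ t ∈ T, ∀ v, v ∉ S → w' t v = w t v)
    (h0 : ∀ u v, u ∉ S → u ∉ T → v ∉ S → v ∉ T → c u ≠ c v → w' u v = w u v) :
    IsBarrier w' S T c := by
  refine ⟨h.disjoint, ?_, ?_⟩
  · intro u v h1 h2 h3 h4 h5
    rw [h0 u v h1 h2 h3 h4 h5]
    exact h.eq_zero u v h1 h2 h3 h4 h5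
  · have h1 : degreeSum w' S T = degreeSum w S T := by
      refine sum_congr rfl fun t ht => ?_
      rw [hT t ht t (disjoint_right.1 h.disjoint ht)]
      congr 1
      exact sum_congr rfl fun v hv => hT t ht v (mem_compl.1 hv)
    have h2 : ∀ l, labelCount w' S T c l = labelCount w S T c l := by
      intro l
      refine sum_congr rfl fun t ht => sum_congr rfl fun v hv => hT t ht v ?_
      simp only [mem_filter, mem_compl, mem_union, not_or] at hv
      exact hv.1.1
    have h3 : oddLabels w' S T c = oddLabels w S T c := by
      ext l; rw [mem_oddLabels, mem_oddLabels, h2]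
    rw [h1, h3]
    exact h.lt

variable {w : V → V → ℕ} {S T : Finset V} {c : V → ι}

theorem IsMaximal.le_of_barrier (hw : IsMaximal w) {x y : V}
    (h : IsBarrier (addOne w x y) S T c) : (if x = y then 1 else 2) ≤ w x y := by
  by_contra hcon
  exact h.not_hasTwoFactor (hw.hasTwoFactor_addOne x y (not_le.1 hcon))

theorem IsMaximal.le_of_mem (hw : IsMaximal w) (h : IsBarrier w S T c) {x : V} (hx : x ∈ S)
    (y : V) : (if x = y then 1 else 2) ≤ w x y := by
  refine hw.le_of_barrier (h.congr (S := S) (T := T) (c := c) ?_ ?_)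
  · intro t ht v hv
    apply addOne_eq
    rintro (⟨rfl, rfl⟩ | ⟨rfl, rfl⟩)
    · exact disjoint_left.1 h.disjoint hx ht
    · exact hv hx
  · intro u v hu _ hv _ _
    apply addOne_eq
    rintro (⟨rfl, rfl⟩ | ⟨rfl, rfl⟩)
    · exact hu hx
    · exact hv hx

theorem IsMaximal.le_of_label_eq (hw : IsMaximal w) (h : IsBarrier w S T c) {x y : V}
    (hxS : x ∉ S) (hxT : x ∉ T) (hyT : y ∉ T) (hxy : c x = c y) :
    (if x = y then 1 else 2) ≤ w x y := by
  refine hw.le_of_barrier (h.congr (S := S) (T := T) (c := c) ?_ ?_)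
  · intro t ht v hv
    apply addOne_eq
    rintro (⟨rfl, rfl⟩ | ⟨rfl, rfl⟩)
    · exact hxT ht
    · exact hyT ht
  · intro u v hu _ hv _ hne
    apply addOne_eq
    rintro (⟨rfl, rfl⟩ | ⟨rfl, rfl⟩)
    · exact hne hxy
    · exact hne hxy.symm

end MultMatrix

/-! ### Necessity of the conditions -/

namespace MultMatrix

open Finset

variable {V : Type*} {ι : Type*} [DecidableEq ι] [DecidableEq V] [Fintype V]
  {w : V → V → ℕ} {S T : Finset V} {c : V → ι}

theorem mem_outside {u : V} : u ∈ (S ∪ T)ᶜ ↔ u ∉ S ∧ u ∉ T := by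
  rw [mem_compl, mem_union, not_or]

/-- For independent `T`, both sides of the barrier inequality have the same parity. -/
theorem IsBarrier.add_two_le (h : IsBarrier w S T c) (hT : ∀ u ∈ T, ∀ v ∈ T, w u v = 0) :
    2 * #S + degreeSum w S T + 2 ≤ 2 * #T + #(oddLabels w S T c) := by
  have h1 := h.lt
  have h2 := degreeSum_of_independent h.disjoint hT
  rw [sum_labelCount w S T c] at h2
  -- For independent `T` the degree sum is the sum of all label counts, so it is congruent mod 2 to
  -- the number of odd labels. Hence strict inequality means a gap of at least 2.
  have h3 := odd_sum_iff_odd_card_odd (s := (S ∪ T)ᶜ.image c) (labelCount w S T c)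
  rw [← h2] at h3
  change _ ↔ Odd #(oddLabels w S T c) at h3
  rw [Nat.odd_iff, Nat.odd_iff] at h3
  omega

/-- A loop at a vertex of `T` raises `degreeSum` by 2 and changes no label count. An excess above 2
would survive this; together with `IsBarrier.add_two_le`, the excess is exactly 2. -/
theorem IsMaximal.exists_loopless_of_barrier (hw : IsMaximal w) (h : IsBarrier w S T c)
    (hT : ∀ u ∈ T, ∀ v ∈ T, w u v = 0) (hne : T.Nonempty) :
    2 * #T + #(oddLabels w S T c) ≤ 2 * #S + degreeSum w S T + 2 := by
  obtain ⟨t, ht⟩ := hne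
  by_contra hcon
  have hb : IsBarrier (addOne w t t) S T c := by
    refine ⟨h.disjoint, ?_, ?_⟩
    · intro u v h1 h2 h3 h4 h5
      rw [addOne_eq]
      · exact h.eq_zero u v h1 h2 h3 h4 h5
      · rintro (⟨rfl, rfl⟩ | ⟨rfl, rfl⟩) <;> exact h5 rfl
    · have h1 : degreeSum (addOne w t t) S T = degreeSum w S T + 2 := by
        have h4 : ∀ u ∈ T, ∑ v ∈ Sᶜ, addOne w t t u v + addOne w t t u u =
            ∑ v ∈ Sᶜ, w u v + w u u + if u = t then 2 else 0 := by
          intro u _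
          simp only [addOne, or_self, sum_add_distrib, and_self]
          by_cases hut : u = t
          · have h5 : t ∈ Sᶜ := mem_compl.2 (disjoint_right.1 h.disjoint ht)
            simp only [hut, true_and, if_true, sum_ite_eq', h5]
            omega
          · simp [hut]
        rw [degreeSum, sum_congr rfl h4, sum_add_distrib, sum_ite_eq', if_pos ht, degreeSum]
      have h2 : ∀ l, labelCount (addOne w t t) S T c l = labelCount w S T c l := by
        intro l
        refine sum_congr rfl fun u _ => sum_congr rfl fun v hv => addOne_eq ?_
        rw [mem_filter, mem_outside] at hv
        rintro (⟨-, rfl⟩ | ⟨-, rfl⟩) <;> exact hv.1.2 ht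
      have h3 : oddLabels (addOne w t t) S T c = oddLabels w S T c := by
        ext l; rw [mem_oddLabels, mem_oddLabels, h2]
      rw [h1, h3]
      omega
  have h1 := hw.le_of_barrier hb
  rw [if_pos rfl, hT t ht t ht] at h1
  omega

/-- A label class sending an even number of edges to `T` is completely joined to `T`. -/
theorem IsMaximal.two_le_of_not_odd (hw : IsMaximal w) (h : IsBarrier w S T c)
    {t u : V} (ht : t ∈ T) (huS : u ∉ S) (huT : u ∉ T) (hodd : ¬ Odd (labelCount w S T c (c u))) :
    2 ≤ w t u := by
  have htu : t ≠ u := fun e => huT (e ▸ ht)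
  have hδ : ∀ X : Finset V, u ∈ X → ∑ t' ∈ T, ∑ v ∈ X, addOne w t u t' v =
      ∑ t' ∈ T, ∑ v ∈ X, w t' v + 1 := by
    intro X hX
    have h4 : ∀ t' ∈ T, ∑ v ∈ X, addOne w t u t' v =
        ∑ v ∈ X, w t' v + if t' = t then 1 else 0 := by
      intro t' ht'
      have h5 : t' ≠ u := fun e => huT (e ▸ ht')
      by_cases h6 : t' = t
      · simp [addOne, sum_add_distrib, h6, htu, hX]
      · simp [addOne, h5, h6]
    rw [sum_congr rfl h4, sum_add_distrib, sum_ite_eq', if_pos ht]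
  -- The new edge raises `degreeSum` by one and makes the class of `u` odd, so both sides of the
  -- inequality grow equally.
  have hb : IsBarrier (addOne w t u) S T c := by
    refine ⟨h.disjoint, ?_, ?_⟩
    · intro u' v h1 h2 h3 h4 h5
      rw [addOne_eq]
      · exact h.eq_zero u' v h1 h2 h3 h4 h5
      · rintro (⟨rfl, rfl⟩ | ⟨rfl, rfl⟩)
        · exact h2 ht
        · exact h4 ht
    · have h1 : degreeSum (addOne w t u) S T = degreeSum w S T + 1 := by
        have h4 : ∑ t' ∈ T, addOne w t u t' t' = ∑ t' ∈ T, w t' t' := by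
          refine sum_congr rfl fun t' _ => addOne_eq ?_
          rintro (⟨rfl, e⟩ | ⟨rfl, e⟩)
          · exact htu e
          · exact htu e.symm
        rw [degreeSum, sum_add_distrib, hδ _ (mem_compl.2 huS), h4, degreeSum, sum_add_distrib]
        omega
      have h2 : ∀ l, l ≠ c u → labelCount (addOne w t u) S T c l = labelCount w S T c l := by
        intro l hl
        refine sum_congr rfl fun t' _ => sum_congr rfl fun v hv => addOne_eq ?_
        rw [mem_filter, mem_outside] at hv
        rintro (⟨-, rfl⟩ | ⟨-, rfl⟩)
        · exact hl hv.2.symm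
        · exact hv.1.2 ht
      have h3 : labelCount (addOne w t u) S T c (c u) = labelCount w S T c (c u) + 1 :=
        hδ _ (mem_filter.2 ⟨mem_outside.2 ⟨huS, huT⟩, rfl⟩)
      have h4 : oddLabels (addOne w t u) S T c = insert (c u) (oddLabels w S T c) := by
        ext l
        rw [mem_insert, mem_oddLabels, mem_oddLabels]
        by_cases hl : l = c u
        · subst hl
          rw [h3]
          simp only [true_or, iff_true]
          exact (Nat.not_odd_iff_even.1 hodd).add_one
        · simp [h2 l hl, hl]
      have h5 : c u ∉ oddLabels w S T c := by rwa [mem_oddLabels]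
      rw [h1, h4, card_insert_of_notMem h5]
      have := h.lt
      omega
  have h1 := hw.le_of_barrier hb
  rwa [if_neg htu] at h1

/-- A vertex outside `S ∪ T` joined to `T` by at least two edges can be moved into `S`. -/
theorem IsBarrier.insert_left (h : IsBarrier w S T c) (hT : ∀ u ∈ T, ∀ v ∈ T, w u v = 0)
    {u : V} (huS : u ∉ S) (huT : u ∉ T) (hu : 2 ≤ ∑ t ∈ T, w t u) :
    IsBarrier w (insert u S) T c := by
  have hdisj : Disjoint (insert u S) T := disjoint_insert_left.2 ⟨huT, h.disjoint⟩
  have hU : (insert u S ∪ T)ᶜ = (S ∪ T)ᶜ.erase u := by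
    ext v; simp only [mem_outside, mem_erase, mem_insert]; tauto
  refine ⟨hdisj, ?_, ?_⟩
  · intro u' v h1 h2 h3 h4 h5
    rw [mem_insert, not_or] at h1 h3
    exact h.eq_zero u' v h1.2 h2 h3.2 h4 h5
  · have h1 : degreeSum w (insert u S) T + ∑ t ∈ T, w t u = degreeSum w S T := by
      rw [degreeSum_of_independent hdisj hT, degreeSum_of_independent h.disjoint hT, hU,
        ← sum_add_distrib]
      exact sum_congr rfl fun t _ => sum_erase_add _ _ (mem_outside.2 ⟨huS, huT⟩)
    have h2 : (oddLabels w S T c).erase (c u) ⊆ oddLabels w (insert u S) T c := by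
      intro l hl
      rw [mem_erase, mem_oddLabels] at hl
      rw [mem_oddLabels]
      convert hl.2 using 1
      refine sum_congr rfl fun t _ => sum_congr ?_ fun _ _ => rfl
      rw [hU]
      ext v
      simp only [mem_filter, mem_erase]
      constructor
      · rintro ⟨⟨-, h3⟩, h4⟩
        exact ⟨h3, h4⟩
      · rintro ⟨h3, h4⟩
        exact ⟨⟨fun e => hl.1 (e ▸ h4.symm), h3⟩, h4⟩
    have h3 := card_le_card h2
    have h4 := pred_card_le_card_erase (s := oddLabels w S T c) (a := c u)
    have h5 := h.add_two_le hT
    rw [card_insert_of_notMem huS]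
    omega

/-- A subset of `T` violating the surplus condition can be moved out of `T`. -/
theorem IsBarrier.sdiff_right (h : IsBarrier w S T c) (hw : ∀ u v, w u v = w v u)
    (hT : ∀ u ∈ T, ∀ v ∈ T, w u v = 0) {A' : Finset V} (hA' : A' ⊆ T) {L' : Finset ι}
    (hlt : 2 * #A' + #L' < 2 + ∑ l ∈ L', ∑ t ∈ A', ∑ u ∈ (S ∪ T)ᶜ with c u = l, w t u) :
    ∃ c' : V → Option ι, IsBarrier w S (T \ A') c' := by
  let e : ι → ℕ := fun l => ∑ t ∈ A', ∑ u ∈ (S ∪ T)ᶜ with c u = l, w t u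
  let N : Finset ι := {l ∈ (S ∪ T)ᶜ.image c | e l ≠ 0}
  have he : ∀ l, l ∉ N → e l = 0 := by
    intro l hl
    by_contra h0
    apply hl
    obtain ⟨t, -, ht⟩ := exists_ne_zero_of_sum_ne_zero h0
    obtain ⟨u, hu, -⟩ := exists_ne_zero_of_sum_ne_zero ht
    rw [mem_filter] at hu
    exact mem_filter.2 ⟨mem_image.2 ⟨u, hu.1, hu.2⟩, h0⟩
  have hsplit : ∀ l, labelCount w S T c l =
      ∑ t ∈ T \ A', ∑ u ∈ (S ∪ T)ᶜ with c u = l, w t u + e l := fun l =>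
    (sum_sdiff hA').symm
  -- The set `N` of labels with edges to `A'` violates the surplus at least as strongly as `L'`:
  -- labels with `e l = 0` only help the bound, and all others contribute `e l - 1 ≥ 0` to the
  -- violation.
  have hL : ∑ l ∈ L', e l + #N ≤ ∑ l ∈ N, e l + #L' := by
    rw [card_eq_sum_ones, card_eq_sum_ones, ← sum_inter_add_sum_sdiff L' N e,
      ← sum_inter_add_sum_sdiff N L' e, ← sum_inter_add_sum_sdiff L' N (fun _ => 1),
      ← sum_inter_add_sum_sdiff N L' (fun _ => 1), inter_comm L' N]
    have h1 : ∑ l ∈ L' \ N, e l = 0 := sum_eq_zero fun l hl => he l (mem_sdiff.1 hl).2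
    have h2 : ∑ l ∈ N \ L', 1 ≤ ∑ l ∈ N \ L', e l := sum_le_sum fun l hl =>
      Nat.one_le_iff_ne_zero.2 (mem_filter.1 (mem_sdiff.1 hl).1).2
    omega
  have hlt' : 2 * #A' + #N < 2 + ∑ l ∈ N, e l := by
    change 2 * #A' + #L' < 2 + ∑ l ∈ L', e l at hlt
    omega
  -- `A'` and all classes it has edges to are merged into one class `none`. At most #N odd labels
  -- disappear, which the drop in `degreeSum` covers.
  let c' : V → Option ι := fun v => if v ∈ A' ∨ c v ∈ N then none else some (c v)
  have hdisj : Disjoint S (T \ A') := h.disjoint.mono_right sdiff_subset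
  have hout : ∀ v, v ∉ S → v ∉ T \ A' → v ∉ A' → v ∉ T := by
    intro v _ h2 h3 h4
    exact h2 (mem_sdiff.2 ⟨h4, h3⟩)
  have haN : ∀ a ∈ A', ∀ v, v ∉ S → v ∉ T → c v ∉ N → w a v = 0 := by
    intro a ha v h1 h2 h3
    have h4 := he _ h3
    rw [sum_eq_zero_iff] at h4
    exact sum_eq_zero_iff.1 (h4 a ha) v (mem_filter.2 ⟨mem_outside.2 ⟨h1, h2⟩, rfl⟩)
  refine ⟨c', hdisj, ?_, ?_⟩
  · have key : ∀ u v, u ∉ S → u ∉ T \ A' → v ∉ S → v ∉ T \ A' → c' u = none → c' v ≠ none →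
        w u v = 0 := by
      intro u v hu hu' hv hv' h1 h2
      have h3 : v ∉ A' ∧ c v ∉ N := by
        by_contra h3
        apply h2
        simp only [c']
        rw [if_pos (by tauto)]
      have hvT := hout v hv hv' h3.1
      by_cases h4 : u ∈ A'
      · exact haN u h4 v hv hvT h3.2
      · have h5 : c u ∈ N := by
          by_contra h5
          simp [c', h4, h5] at h1
        exact h.eq_zero u v hu (hout u hu hu' h4) hv hvT fun e => h3.2 (e ▸ h5)
    intro u v hu hu' hv hv' hne
    by_cases h1 : c' u = none
    · exact key u v hu hu' hv hv' h1 fun e => hne (h1.trans e.symm)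
    · by_cases h2 : c' v = none
      · rw [hw]
        exact key v u hv hv' hu hu' h2 h1
      · have h3 : ∀ x, c' x ≠ none → x ∉ A' ∧ c' x = some (c x) := by
          intro x hx
          simp only [c'] at hx ⊢
          split_ifs at hx ⊢ with h4
          · exact absurd rfl hx
          · exact ⟨fun e => h4 (.inl e), rfl⟩
        refine h.eq_zero u v hu (hout u hu hu' (h3 u h1).1) hv (hout v hv hv' (h3 v h2).1)
          fun e => hne ?_
        rw [(h3 u h1).2, (h3 v h2).2, e]
  · have hT' : ∀ u ∈ T \ A', ∀ v ∈ T \ A', w u v = 0 := fun u hu v hv =>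
      hT u (mem_sdiff.1 hu).1 v (mem_sdiff.1 hv).1
    have hsumN : ∑ l ∈ N, e l = ∑ t ∈ A', ∑ u ∈ (S ∪ T)ᶜ, w t u := by
      rw [sum_congr rfl fun t _ => sum_labels (S ∪ T)ᶜ c (w t),
        sum_subset (filter_subset _ _) fun l _ hl => he l hl, sum_comm]
    have h1 : degreeSum w S (T \ A') + ∑ l ∈ N, e l = degreeSum w S T := by
      rw [degreeSum_of_independent hdisj hT', degreeSum_of_independent h.disjoint hT, hsumN,
        ← sum_sdiff hA']
      congr 1
      refine sum_congr rfl fun t ht => (sum_subset ?_ ?_).symm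
      · intro v hv
        rw [mem_outside] at hv ⊢
        exact ⟨hv.1, fun e => hv.2 (mem_sdiff.1 e).1⟩
      · intro v hv hv'
        rw [mem_outside] at hv hv'
        refine hT t (mem_sdiff.1 ht).1 v ?_
        tauto
    have h2 : (oddLabels w S T c \ N).image some ⊆ oddLabels w S (T \ A') c' := by
      intro l hl
      obtain ⟨l, hl', rfl⟩ := mem_image.1 hl
      clear hl
      obtain ⟨hl₁, hl⟩ := mem_sdiff.1 hl'
      rw [mem_oddLabels] at hl₁ ⊢
      convert hl₁ using 1
      rw [hsplit, he l hl, add_zero]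
      refine sum_congr rfl fun t ht => sum_congr ?_ fun _ _ => rfl
      ext v
      simp only [mem_filter, mem_outside, c']
      constructor
      · rintro ⟨⟨h3, h4⟩, h5⟩
        split_ifs at h5 with h6
        rw [not_or] at h6
        exact ⟨⟨h3, hout v h3 h4 h6.1⟩, by simpa using h5⟩
      · rintro ⟨⟨h3, h4⟩, h5⟩
        refine ⟨⟨h3, fun e => h4 (mem_sdiff.1 e).1⟩, ?_⟩
        rw [if_neg, h5]
        rintro (h6 | h6)
        · exact h4 (hA' h6)
        · exact hl (h5 ▸ h6)
    have h3 := card_le_card h2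
    rw [card_image_of_injective _ (Option.some_injective _)] at h3
    have h4 := le_card_sdiff N (oddLabels w S T c)
    have h5 := h.add_two_le hT
    have h6 := card_sdiff_add_card_eq_card hA'
    omega

theorem mem_setB {u : V} : u ∈ setB w ↔ w u u ≠ 0 ∧ ∀ v, v ≠ u → w u v = 2 := by simp [setB]

theorem mem_setC {u : V} : u ∈ setC w ↔ u ∉ setB w ∧ u ∉ setA w := mem_outside

theorem IsMaximal.mem_setB_of_mem (hm : IsMaximal w) (hw2 : ∀ u v, u ≠ v → w u v ≤ 2)
    (h : IsBarrier w S T c) {u : V} (hu : u ∈ S) : u ∈ setB w := by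
  refine mem_setB.2 ⟨?_, fun v hv => ?_⟩
  · have h1 := hm.le_of_mem h hu u
    rw [if_pos rfl] at h1
    omega
  · have h1 := hm.le_of_mem h hu v
    rw [if_neg hv.symm] at h1
    exact le_antisymm (hw2 u v hv.symm) h1

theorem IsBarrier.nonempty_right (h : IsBarrier w S T c) : T.Nonempty := by
  rw [nonempty_iff_ne_empty]
  rintro rfl
  have h1 := h.lt
  have h2 : oddLabels w S ∅ c = ∅ := by
    rw [eq_empty_iff_forall_notMem]
    intro l
    simp [mem_oddLabels, labelCount]
  rw [h2] at h1
  simp at h1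

/-- The barrier has excess exactly 2 and is shown to be (B, A). Each condition then comes from
comparing it with a modified graph or a modified barrier. -/
theorem IsMaximal.exists_conditions (hm : IsMaximal w) (hw : ∀ u v, w u v = w v u)
    (hw2 : ∀ u v, u ≠ v → w u v ≤ 2) :
    ∃ c : V → (V × Bool) ⊕ Dart w, Conditions w c := by
  obtain ⟨S, T, c, h, hT⟩ := exists_isBarrier hw hw2 hm.not_hasTwoFactor
  have heq : 2 * #T + #(oddLabels w S T c) = 2 * #S + degreeSum w S T + 2 :=
    le_antisymm (hm.exists_loopless_of_barrier h hT h.nonempty_right) (h.add_two_le hT)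
  have hD := degreeSum_of_independent h.disjoint hT
  have hTA : T = setA w := by
    ext u
    rw [mem_setA]
    refine ⟨fun hu => hT u hu u hu, fun hu => ?_⟩
    by_contra huT
    by_cases huS : u ∈ S
    · exact (mem_setB.1 (hm.mem_setB_of_mem hw2 h huS)).1 hu
    · have h1 := hm.le_of_label_eq h huS huT huT rfl
      rw [if_pos rfl] at h1
      omega
  have hSB : S = setB w := by
    ext u
    refine ⟨hm.mem_setB_of_mem hw2 h, fun hu => ?_⟩
    by_contra huS
    obtain ⟨h1, h2⟩ := mem_setB.1 hu
    have huT : u ∉ T := fun e => h1 (hT u e u e)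
    -- A vertex of B outside `S` is adjacent to everything, so there is a single label class, while
    -- it sends two edges to each vertex of `T`. Then the excess is at most 1.
    have h3 : oddLabels w S T c ⊆ {c u} := by
      intro l hl
      obtain ⟨v, hv, rfl⟩ := mem_image.1 (mem_filter.1 hl).1
      rw [mem_outside] at hv
      rw [mem_singleton]
      by_contra hne
      have h4 := h.eq_zero u v huS huT hv.1 hv.2 (Ne.symm hne)
      rw [h2 v fun e => hne (by rw [e])] at h4
      omega
    have h4 := card_le_card h3
    rw [card_singleton] at h4
    have h5 : 2 * #T ≤ degreeSum w S T := by
      rw [hD, mul_comm, ← smul_eq_mul]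
      refine card_nsmul_le_sum _ _ _ fun t ht => ?_
      have htu : t ≠ u := fun e => huT (e ▸ ht)
      rw [← h2 t htu, hw]
      exact single_le_sum (f := w t) (fun _ _ => Nat.zero_le _) (mem_outside.2 ⟨huS, huT⟩)
    omega
  have hodd : ∀ u, u ∉ S → u ∉ T → Odd (labelCount w S T c (c u)) := by
    intro u huS huT
    by_contra hcon
    -- An even class is doubly joined to all of `T`. Adding at least one edge from each odd class
    -- makes `degreeSum` too large for a positive excess.
    have h1 : 2 * #T ≤ labelCount w S T c (c u) := by
      rw [labelCount, mul_comm, ← smul_eq_mul]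
      refine card_nsmul_le_sum _ _ _ fun t ht => ?_
      exact (hm.two_le_of_not_odd h ht huS huT hcon).trans
        (single_le_sum (f := w t) (fun _ _ => Nat.zero_le _)
          (mem_filter.2 ⟨mem_outside.2 ⟨huS, huT⟩, rfl⟩))
    have h2 : #(oddLabels w S T c) + labelCount w S T c (c u) ≤ degreeSum w S T := by
      have h3 : c u ∈ (S ∪ T)ᶜ.image c := mem_image_of_mem c (mem_outside.2 ⟨huS, huT⟩)
      rw [hD, sum_labelCount w S T c, ← sum_erase_add _ _ h3]
      apply Nat.add_le_add_right
      have h4 : oddLabels w S T c ⊆ ((S ∪ T)ᶜ.image c).erase (c u) := by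
        intro l hl
        rw [mem_erase]
        exact ⟨fun e => hcon (e ▸ mem_oddLabels.1 hl), (mem_filter.1 hl).1⟩
      calc #(oddLabels w S T c) = ∑ l ∈ oddLabels w S T c, 1 := card_eq_sum_ones _
        _ ≤ ∑ l ∈ oddLabels w S T c, labelCount w S T c l :=
          sum_le_sum fun l hl => (mem_oddLabels.1 hl).pos
        _ ≤ _ := sum_le_sum_of_subset h4
    omega
  have hq : oddLabels w S T c = (S ∪ T)ᶜ.image c := by
    refine filter_true_of_mem fun l hl => ?_
    obtain ⟨v, hv, rfl⟩ := mem_image.1 hl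
    rw [mem_outside] at hv
    exact hodd v hv.1 hv.2
  have hsurplus : ∀ A' ⊆ T, A'.Nonempty → ∀ L' : Finset ((V × Bool) ⊕ Dart w),
      2 + ∑ l ∈ L', ∑ a ∈ A', ∑ u ∈ (S ∪ T)ᶜ with c u = l, w a u ≤ 2 * #A' + #L' := by
    rintro A' hA' ⟨a, ha⟩ L'
    by_contra hcon
    -- Removing `A'` from `T` leaves a barrier with `a` outside both sets, which forces a loop at
    -- `a`, although `T` is loopless.
    obtain ⟨c', hc'⟩ := h.sdiff_right hw hT hA' (not_le.1 hcon)
    have haS : a ∉ S := disjoint_right.1 h.disjoint (hA' ha)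
    have haT : a ∉ T \ A' := fun e => (mem_sdiff.1 e).2 ha
    have h1 := hm.le_of_label_eq hc' haS haT haT rfl
    rw [if_pos rfl, hT a (hA' ha) a (hA' ha)] at h1
    omega
  have hcard : 2 * #T + #((S ∪ T)ᶜ.image c) =
      2 * #S + ∑ a ∈ T, ∑ u ∈ (S ∪ T)ᶜ, w a u + 2 := by
    rw [← hq, ← hD, heq]
  have hright : ∀ u, u ∉ S → u ∉ T → ∑ a ∈ T, w a u ≤ 1 := by
    intro u huS huT
    by_contra hcon
    have h1 := hm.mem_setB_of_mem hw2 (h.insert_left hT huS huT (by omega))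
      (mem_insert_self u S)
    exact huS (hSB ▸ h1)
  have hzero := h.eq_zero
  have hcomplete : ∀ u v, u ∉ S → u ∉ T → v ∉ T → u ≠ v → c u = c v → w u v = 2 := by
    intro u v h1 h2 h4 huv hc
    have h5 := hm.le_of_label_eq h h1 h2 h4 hc
    rw [if_neg huv] at h5
    exact le_antisymm (hw2 u v huv) h5
  clear heq hD hq h
  subst hTA hSB
  refine ⟨c, hT, ?_, ?_, ?_, ?_, ?_, hcard, fun A' hA' hne L' _ => hsurplus A' hA' hne L'⟩
  · intro u hu v hv
    rw [mem_setC] at hu hv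
    exact hzero u v hu.1 hu.2 hv.1 hv.2
  · intro u hu v hv
    rw [mem_setC] at hu hv
    exact hcomplete u v hu.1 hu.2 hv.2
  · intro a ha l
    -- One vertex and one label: the surplus reads 2 + e ≤ 2 + 1.
    have h1 := hsurplus {a} (singleton_subset_iff.2 ha) (singleton_nonempty a) {l}
    simp only [sum_singleton, card_singleton] at h1
    change 2 + ∑ u ∈ setC w with c u = l, w a u ≤ _ at h1
    omega
  · intro u hu
    rw [mem_setC] at hu
    exact hright u hu.1 hu.2
  · intro u hu
    rw [mem_setC] at hu
    exact hodd u hu.1 hu.2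

end MultMatrix

/-! ### Completing a selection of edges to a 2-factor -/

namespace MultMatrix

open Finset

theorem exists_pairing {V : Type*} [DecidableEq V] (s : Finset V) (hs : Even #s) :
    ∃ σ : V → V, ∀ u ∈ s, σ u ∈ s ∧ σ u ≠ u ∧ σ (σ u) = u := by
  obtain ⟨n, hn⟩ := hs
  have e : s ≃ Fin n × Bool := Fintype.equivOfCardEq (by simp [hn, mul_two])
  let τ : s → s := fun u => e.symm ((e u).1, !(e u).2)
  have hτ : ∀ u, τ u ≠ u ∧ τ (τ u) = u := by
    intro u
    constructor
    · intro h
      have h1 := congrArg e h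
      simp only [τ, Equiv.apply_symm_apply] at h1
      have h2 := congrArg Prod.snd h1
      simp at h2
    · simp [τ]
  refine ⟨fun u => if h : u ∈ s then τ ⟨u, h⟩ else u, fun u hu => ?_⟩
  obtain ⟨h1, h2⟩ := hτ ⟨u, hu⟩
  have h3 : (τ ⟨u, hu⟩).1 ∈ s := (τ ⟨u, hu⟩).2
  simp only [hu, dif_pos, h3, h2, Subtype.coe_eta, true_and, and_true]
  exact fun h => h1 (Subtype.ext h)

/-- A nonnegative integer matrix with given row sums and constant column sums. -/
theorem exists_transport {V : Type*} [DecidableEq V] [Fintype V] (A B : Finset V) (n : V → ℕ)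
    (k : ℕ) (h : ∑ a ∈ A, n a = k * #B) :
    ∃ M : V → V → ℕ, (∀ a b, a ∉ A ∨ b ∉ B → M a b = 0) ∧ (∀ a ∈ A, ∑ b, M a b = n a) ∧
      ∀ b ∈ B, ∑ a, M a b = k := by
  -- Split each row `a` into `n a` units and each column into `k` units. Any bijection of the units
  -- gives a suitable matrix.
  have hcard : #(A.sigma fun a => range (n a)) = #(B ×ˢ range k) := by
    simp [card_sigma, h, mul_comm]
  let e := equivOfCardEq hcard
  let M : V → V → ℕ := fun a b =>
    #{z : (A.sigma fun a => range (n a) : Finset _) | z.1.1 = a ∧ (e z).1.1 = b}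
  refine ⟨M, ?_, ?_, ?_⟩
  · intro a b hab
    rw [card_eq_zero, filter_eq_empty_iff]
    rintro z - ⟨rfl, rfl⟩
    have h1 := (mem_sigma.1 z.2).1
    have h2 := (mem_product.1 (e z).2).1
    tauto
  · intro a ha
    have h1 : ∑ b, M a b = #{z : (A.sigma fun a => range (n a) : Finset _) | z.1.1 = a} := by
      rw [card_eq_sum_card_fiberwise (f := fun z => (e z).1.1) (t := univ) (fun _ _ => mem_univ _)]
      simp only [filter_filter, M]
    rw [h1, ← card_map (Function.Embedding.subtype _)]
    have h2 : (filter (fun z : (A.sigma fun a => range (n a) : Finset _) => z.1.1 = a) univ).map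
        (Function.Embedding.subtype _) = ({a} : Finset V).sigma fun a => range (n a) := by
      ext ⟨a', i⟩
      simp only [mem_map, mem_filter, mem_univ, true_and, Function.Embedding.subtype_apply,
        mem_sigma, mem_singleton]
      constructor
      · rintro ⟨z, hz, hz'⟩
        have h3 := (mem_sigma.1 z.2).2
        rw [hz'] at hz h3
        exact ⟨hz, h3⟩
      · rintro ⟨rfl, hi⟩
        exact ⟨⟨⟨a', i⟩, mem_sigma.2 ⟨ha, hi⟩⟩, rfl, rfl⟩
    rw [h2, card_sigma, sum_singleton, card_range]
  · intro b hb
    have h1 : ∑ a, M a b =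
        #{z : (A.sigma fun a => range (n a) : Finset _) | (e z).1.1 = b} := by
      rw [card_eq_sum_card_fiberwise (f := fun z => z.1.1) (t := univ) (fun _ _ => mem_univ _)]
      simp only [filter_filter, M, and_comm]
    have h2 : #{z : (A.sigma fun a => range (n a) : Finset _) | (e z).1.1 = b} =
        #{z : (B ×ˢ range k : Finset _) | z.1.1 = b} := by
      rw [← card_map e.toEmbedding]
      congr 1
      ext z
      simp only [mem_map, mem_filter, mem_univ, true_and, Equiv.coe_toEmbedding]
      exact ⟨fun ⟨y, hy, hyz⟩ => hyz ▸ hy, fun hz => ⟨e.symm z, by simpa using hz, by simp⟩⟩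
    rw [h1, h2, ← card_map (Function.Embedding.subtype _)]
    have h3 : (filter (fun z : (B ×ˢ range k : Finset _) => z.1.1 = b) univ).map
        (Function.Embedding.subtype _) = {b} ×ˢ range k := by
      ext ⟨b', i⟩
      simp only [mem_map, mem_filter, mem_univ, true_and, Function.Embedding.subtype_apply,
        mem_product, mem_singleton]
      constructor
      · rintro ⟨z, hz, hz'⟩
        have h3 := (mem_product.1 z.2).2
        rw [hz'] at hz h3
        exact ⟨hz, h3⟩
      · rintro ⟨rfl, hi⟩
        exact ⟨⟨⟨b', i⟩, mem_product.2 ⟨hb, hi⟩⟩, rfl, rfl⟩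
    rw [h3, card_product, card_singleton, card_range, one_mul]

variable {V : Type*} {ι : Type*} [DecidableEq ι] [DecidableEq V]

/-- The number of ends at `u` of an edge joining `x` and `y`. -/
def ends (x y u : V) : ℕ := (if u = x then 1 else 0) + if u = y then 1 else 0

theorem sum_ends (x y : V) (s : Finset V) :
    ∑ u ∈ s, ends x y u = (if x ∈ s then 1 else 0) + if y ∈ s then 1 else 0 := by
  simp [ends, sum_add_distrib]

variable [Fintype V] {w : V → V → ℕ} {c : V → ι}

theorem hasTwoFactor_addOne {m : V → V → ℕ} (x y : V) (hm : ∀ u v, m u v = m v u)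
    (hmw : ∀ u v, m u v ≤ w u v) (hdeg : ∀ u, ∑ v, m u v + m u u + ends x y u = 2) :
    HasTwoFactor (addOne w x y) := by
  refine ⟨addOne m x y, ?_, ?_, ?_⟩
  · intro u v
    rw [addOne, addOne, hm]
    congr 2
    apply propext
    tauto
  · intro u v
    exact Nat.add_le_add_right (hmw u v) _
  · intro u
    rw [← hdeg u]
    simp only [addOne, sum_add_distrib, ends]
    by_cases hx : u = x
    · subst hx
      by_cases hy : u = y
      · subst hy
        simp only [true_and, or_self, sum_ite_eq', mem_univ, if_true]
        omega
      · simp [hy]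
        omega
    · by_cases hy : u = y
      · subst hy
        simp [hx]
        omega
      · simp [hx, hy]

theorem disjoint_setB_setA : Disjoint (setB w) (setA w) := by
  rw [disjoint_left]
  intro u hu hu'
  exact (mem_setB.1 hu).1 (mem_setA.1 hu')

/-- Every component is odd, so condition 4 states that (B, A) has excess exactly 2. -/
theorem Conditions.isBarrier (h : Conditions w c) : IsBarrier w (setB w) (setA w) c := by
  refine ⟨disjoint_setB_setA, ?_, ?_⟩
  · intro u v h1 h2 h3 h4
    exact h.eq_zero u (mem_setC.2 ⟨h1, h2⟩) v (mem_setC.2 ⟨h3, h4⟩)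
  · have h1 : oddLabels w (setB w) (setA w) c = (setC w).image c := by
      refine filter_true_of_mem fun l hl => ?_
      obtain ⟨v, hv, rfl⟩ := mem_image.1 hl
      exact h.odd v hv
    have h2 := h.card_eq
    rw [degreeSum_of_independent disjoint_setB_setA h.independent, h1]
    simp only [setC] at h2 ⊢
    omega

/-- A selection of edges between `setA w` and `setC w` extends to a 2-factor, together with an
additional edge joining `x` and `y`, if the degrees admit this. -/
theorem Conditions.hasTwoFactor_of_selection (h : Conditions w c) (hw : ∀ u v, w u v = w v u)
    {x y : V} (hx : x ∉ setB w) (hy : y ∉ setB w) (hxy : x ∈ setC w → x ≠ y) {F : V → V → ℕ}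
    (hF : ∀ a u, a ∉ setA w ∨ u ∉ setC w → F a u = 0) (hFw : ∀ a u, F a u ≤ w a u)
    (hdeg : ∀ a ∈ setA w, ∑ u, F a u + ends x y a ≤ 2)
    (heven : ∀ l, Even (∑ u ∈ setC w with c u = l, (∑ a, F a u + ends x y u)))
    (hsum : ∑ a ∈ setA w, (∑ u, F a u + ends x y a) + 2 * #(setB w) = 2 * #(setA w)) :
    HasTwoFactor (addOne w x y) := by
  have hAB : ∀ u ∈ setA w, u ∉ setB w := fun u hu =>
    disjoint_right.1 disjoint_setB_setA hu
  have hAC : ∀ u ∈ setA w, u ∉ setC w := fun u hu hu' => (mem_setC.1 hu').2 hu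
  have hBC : ∀ u ∈ setB w, u ∉ setC w := fun u hu hu' => (mem_setC.1 hu').1 hu
  -- `M` supplies the remaining degree in A from the vertices of B, each of which gives both its
  -- edge ends to A.
  obtain ⟨M, hM0, hMA, hMB⟩ := exists_transport (setA w) (setB w)
    (fun a => 2 - (∑ u, F a u + ends x y a)) 2 (by
      have h1 : ∑ a ∈ setA w, (2 - (∑ u, F a u + ends x y a)) +
          ∑ a ∈ setA w, (∑ u, F a u + ends x y a) = ∑ a ∈ setA w, 2 := by
        rw [← sum_add_distrib]
        exact sum_congr rfl fun a ha => Nat.sub_add_cancel (hdeg a ha)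
      rw [sum_const, smul_eq_mul] at h1
      omega)
  -- `k u` is the degree already used at `u`, at most one from A and at most one from the new edge.
  let k : V → ℕ := fun u => ∑ a, F a u + ends x y u
  have hk : ∀ u ∈ setC w, k u ≤ 2 := by
    intro u hu
    have h1 : ∑ a, F a u ≤ 1 := by
      refine le_trans ?_ (h.right_le_one u hu)
      rw [← sum_subset (subset_univ (setA w)) fun a _ ha => hF a u (.inl ha)]
      exact sum_le_sum fun a _ => hFw a u
    have h2 : ends x y u ≤ 1 := by
      rw [ends]
      split_ifs with h3 h4
      · exact absurd (h3.symm.trans h4) (hxy (h3 ▸ hu))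
      all_goals omega
    exact Nat.add_le_add h1 h2
  have hpair := fun l => exists_pairing {u ∈ setC w | c u = l ∧ Odd (k u)} (by
    have h1 := odd_sum_iff_odd_card_odd (s := {u ∈ setC w | c u = l}) k
    rw [filter_filter] at h1
    rw [← Nat.not_odd_iff_even, ← h1, Nat.not_odd_iff_even]
    exact heven l)
  choose σ hσ using hpair
  simp only [mem_filter] at hσ
  -- Inside a component, a vertex with `k u = 0` takes its loop, those with `k u = 1` are paired off
  -- by single edges, and those with `k u = 2` take nothing.
  let P : V → V → ℕ := fun u v => if u ∈ setC w ∧ v ∈ setC w then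
    (if u = v then (if k u = 0 then 1 else 0)
    else if Odd (k u) ∧ c v = c u ∧ σ (c u) u = v then 1 else 0) else 0
  have hP : ∀ u v, P u v = P v u := by
    have h1 : ∀ u v, u ∈ setC w → (Odd (k u) ∧ c v = c u ∧ σ (c u) u = v) →
        (Odd (k v) ∧ c u = c v ∧ σ (c v) v = u) := by
      rintro u v hu ⟨h2, h3, h4⟩
      obtain ⟨⟨-, -, h5⟩, -, h6⟩ := hσ (c u) u ⟨hu, rfl, h2⟩
      rw [h4] at h5 h6
      exact ⟨h5, h3.symm, by rw [h3, h6]⟩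
    intro u v
    by_cases huv : u = v
    · rw [huv]
    · by_cases hC : u ∈ setC w ∧ v ∈ setC w
      · simp only [P, hC, and_self, if_true, huv, Ne.symm huv, if_false]
        congr 1
        exact propext ⟨h1 u v hC.1, h1 v u hC.2⟩
      · simp only [P]
        rw [if_neg hC, if_neg fun e => hC e.symm]
  have hP0 : ∀ u v, u ∉ setC w ∨ v ∉ setC w → P u v = 0 := by
    intro u v huv
    simp only [P]
    rw [if_neg (by tauto)]
  have hPw : ∀ u v, P u v ≤ w u v := by
    intro u v
    by_cases hC : u ∈ setC w ∧ v ∈ setC w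
    · simp only [P, hC, and_self, if_true]
      split_ifs with h1 h2 h3
      · subst h1
        have h4 := (mem_setC.1 hC.1).2
        rw [mem_setA] at h4
        omega
      · exact Nat.zero_le _
      · rw [h.eq_two u hC.1 v hC.2 h1 h3.2.1.symm]
        omega
      · exact Nat.zero_le _
    · simp only [P]
      rw [if_neg hC]
      exact Nat.zero_le _
  have hPsum : ∀ u ∈ setC w, ∑ v, P u v + P u u + k u = 2 := by
    intro u hu
    have hkodd : Odd (k u) ↔ k u = 1 := by
      have := hk u hu
      constructor
      · rintro ⟨j, hj⟩
        omega
      · rintro e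
        rw [e]
        exact odd_one
    by_cases h1 : Odd (k u)
    · obtain ⟨⟨h2, h3, -⟩, h4, -⟩ := hσ (c u) u ⟨hu, rfl, h1⟩
      rw [sum_eq_single (σ (c u) u)]
      · have h5 : P u (σ (c u) u) = 1 := by simp [P, hu, h2, h3, h1, Ne.symm h4]
        have h6 : P u u = 0 := by simp [P, hkodd.1 h1]
        rw [h5, h6, hkodd.1 h1]
      · intro v _ hv
        simp only [P]
        split_ifs with h5 h6 h7 h8
        · rw [hkodd.1 h1] at h7
          omega
        · rfl
        · exact absurd h8.2.2.symm hv
        · rfl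
        · rfl
      · simp
    · rw [sum_eq_single u]
      · simp only [P, hu, and_self, if_true]
        have h2 := hk u hu
        rw [hkodd] at h1
        split_ifs <;> omega
      · intro v _ hv
        simp [P, h1, Ne.symm hv]
      · simp
  refine hasTwoFactor_addOne (m := fun u v => M u v + M v u + (F u v + F v u) + P u v) x y
    ?_ ?_ ?_
  · intro u v
    rw [hP u v]
    omega
  · intro u v
    have hMw : ∀ a b, M a b ≤ w a b := by
      intro a b
      by_cases hab : a ∈ setA w ∧ b ∈ setB w
      · have h1 : M a b ≤ 2 := by
          rw [← hMB b hab.2]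
          exact single_le_sum (f := fun a => M a b) (fun _ _ => Nat.zero_le _) (mem_univ a)
        rwa [hw a b, (mem_setB.1 hab.2).2 a fun e => hAB a hab.1 (e ▸ hab.2)]
      · rw [hM0 a b (by tauto)]
        exact Nat.zero_le _
    have hcases : ∀ u, (u ∈ setA w ∧ u ∉ setB w ∧ u ∉ setC w) ∨
        (u ∉ setA w ∧ u ∈ setB w ∧ u ∉ setC w) ∨ (u ∉ setA w ∧ u ∉ setB w ∧ u ∈ setC w) := by
      intro u
      by_cases h1 : u ∈ setA w
      · exact .inl ⟨h1, hAB u h1, hAC u h1⟩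
      · by_cases h2 : u ∈ setB w
        · exact .inr (.inl ⟨h1, h2, hBC u h2⟩)
        · exact .inr (.inr ⟨h1, h2, mem_setC.2 ⟨h2, h1⟩⟩)
    have e1 := hM0 u v
    have e2 := hM0 v u
    have e3 := hF u v
    have e4 := hF v u
    have e5 := hP0 u v
    have l1 := hMw u v
    have l2 := (hMw v u).trans_eq (hw v u)
    have l3 := hFw u v
    have l4 := (hFw v u).trans_eq (hw v u)
    have l5 := hPw u v
    rcases hcases u with hu | hu | hu <;> rcases hcases v with hv | hv | hv <;>
      simp only [hu, hv, not_true_eq_false, not_false_eq_true, or_true, true_or, or_self,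
        forall_const] at e1 e2 e3 e4 e5 <;> omega
  · intro u
    have hMr : u ∉ setA w → ∑ v, M u v = 0 := fun hu => sum_eq_zero fun v _ => hM0 u v (.inl hu)
    have hMc : u ∉ setB w → ∑ v, M v u = 0 := fun hu => sum_eq_zero fun v _ => hM0 v u (.inr hu)
    have hFr : u ∉ setA w → ∑ v, F u v = 0 := fun hu => sum_eq_zero fun v _ => hF u v (.inl hu)
    have hFc : u ∉ setC w → ∑ v, F v u = 0 := fun hu => sum_eq_zero fun v _ => hF v u (.inr hu)
    have hPr : u ∉ setC w → ∑ v, P u v = 0 := fun hu => sum_eq_zero fun v _ => hP0 u v (.inl hu)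
    have hPu : u ∉ setC w → P u u = 0 := fun hu => hP0 u u (.inl hu)
    have hMu : M u u = 0 := hM0 u u (not_and_or.1 fun e => hAB u e.1 e.2)
    have hFu : F u u = 0 := hF u u (not_and_or.1 fun e => hAC u e.1 e.2)
    simp only [sum_add_distrib, hMu, hFu]
    by_cases hA : u ∈ setA w
    · rw [hMA u hA, hMc (hAB u hA), hFc (hAC u hA), hPr (hAC u hA), hPu (hAC u hA)]
      have := hdeg u hA
      omega
    · rw [hMr hA, hFr hA]
      by_cases hB : u ∈ setB w
      · rw [hMB u hB, hFc (hBC u hB), hPr (hBC u hB), hPu (hBC u hB), ends,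
          if_neg fun e : u = x => hx (e ▸ hB), if_neg fun e : u = y => hy (e ▸ hB)]
        omega
      · rw [hMc hB]
        have := hPsum u (mem_setC.2 ⟨hB, hA⟩)
        simp only [k] at this
        omega

end MultMatrix

/-! ### Sufficiency of the conditions, by Hall's theorem -/

namespace MultMatrix

open Finset

variable {V : Type*} {ι : Type*} [DecidableEq ι] [DecidableEq V] [Fintype V]
  {w : V → V → ℕ} {c : V → ι}

/-- The labels of components containing an end of the new edge. -/
def endLabels (w : V → V → ℕ) (c : V → ι) (x y : V) : Finset ι :=
  (if x ∈ setC w then {c x} else ∅) ∪ if y ∈ setC w then {c y} else ∅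

theorem mem_endLabels {x y : V} {l : ι} :
    l ∈ endLabels w c x y ↔ (x ∈ setC w ∧ c x = l) ∨ (y ∈ setC w ∧ c y = l) := by
  rw [endLabels, mem_union]
  split_ifs with h1 h2 h2 <;> simp [h1, h2, eq_comm]

theorem card_endLabels_le (x y : V) : #(endLabels w c x y) ≤
    (if x ∈ setC w then 1 else 0) + if y ∈ setC w then 1 else 0 := by
  refine (card_union_le _ _).trans (Nat.add_le_add ?_ ?_) <;> split_ifs <;> simp

theorem card_endLabels {x y : V} (hxy : x ∈ setC w → y ∈ setC w → c x ≠ c y) :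
    #(endLabels w c x y) = (if x ∈ setC w then 1 else 0) + if y ∈ setC w then 1 else 0 := by
  rw [endLabels]
  split_ifs with h1 h2 h2
  · rw [card_union_of_disjoint (disjoint_singleton.2 (hxy h1 h2)), card_singleton, card_singleton]
  all_goals simp

theorem endLabels_subset (x y : V) : endLabels w c x y ⊆ (setC w).image c := by
  intro l hl
  rcases mem_endLabels.1 hl with ⟨h, rfl⟩ | ⟨h, rfl⟩ <;> exact mem_image_of_mem _ h

/-- By Hall's theorem, one can omit an edge to `setA w` at every component that contains no end of
the new edge so that at most two edges remain at every vertex. -/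
theorem Conditions.exists_omission (h : Conditions w c) (x y : V) :
    ∃ p : ι → V, (∀ l ∈ (setC w).image c \ endLabels w c x y,
        p l ∈ setA w ∧ ∑ u ∈ setC w with c u = l, w (p l) u = 1) ∧
      ∀ a ∈ setA w, ∑ u ∈ setC w, w a u + ends x y a ≤
        2 + #{l ∈ (setC w).image c \ endLabels w c x y | p l = a} := by
  set L := (setC w).image c with hL
  set L₀ := L \ endLabels w c x y with hL₀
  let e : V → ι → ℕ := fun a l => ∑ u ∈ setC w with c u = l, w a u
  let d : V → ℕ := fun a => ∑ u ∈ setC w, w a u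
  -- The number of edges that must be omitted at `a`; truncated subtraction gives 0 when the degree
  -- bound already holds. Hall's theorem is applied to these demands, one element of `J` for each,
  -- and the components in `L₀`.
  let n : V → ℕ := fun a => if a ∈ setA w then d a + ends x y a - 2 else 0
  have hd : ∀ a, d a = ∑ l ∈ L, e a l := fun a => sum_labels _ _ _
  let J := Σ a : V, Fin (n a)
  let t : J → Finset ι := fun j => {l ∈ L₀ | e j.1 l ≠ 0}
  have hall : ∀ s : Finset J, #s ≤ #(s.biUnion t) := by
    intro s
    rcases s.eq_empty_or_nonempty with rfl | hs
    · simp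
    set A' := s.image Sigma.fst with hA'
    have hpos : ∀ a ∈ A', a ∈ setA w ∧ 0 < n a := by
      intro a ha
      obtain ⟨⟨a, i⟩, -, rfl⟩ := mem_image.1 ha
      have h1 : 0 < n a := i.pos
      refine ⟨?_, h1⟩
      by_contra h2
      simp [n, h2] at h1
    have hA'A : A' ⊆ setA w := fun a ha => (hpos a ha).1
    have hcard : #s ≤ ∑ a ∈ A', n a := by
      have h1 : s ⊆ A'.sigma fun a => (univ : Finset (Fin (n a))) := by
        intro j hj
        exact mem_sigma.2 ⟨mem_image_of_mem _ hj, mem_univ _⟩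
      refine (card_le_card h1).trans ?_
      rw [card_sigma]
      exact (sum_congr rfl fun a _ => Finset.card_fin _).le
    have hn : ∑ a ∈ A', n a + 2 * #A' = ∑ a ∈ A', d a + ∑ a ∈ A', ends x y a := by
      rw [mul_comm, ← smul_eq_mul, ← sum_const, ← sum_add_distrib, ← sum_add_distrib]
      refine sum_congr rfl fun a ha => ?_
      obtain ⟨h1, h2⟩ := hpos a ha
      have h3 : n a = d a + ends x y a - 2 := if_pos h1
      change n a + 2 = d a + ends x y a
      omega
    let N : Finset ι := {l ∈ L | ∃ a ∈ A', e a l ≠ 0}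
    -- The surplus condition bounds the total demand of `A'` by #N − 2 plus the number of ends of
    -- the new edge in `A'`.
    have hsur := h.surplus A' hA'A (hs.image _) N (filter_subset _ _)
    have hNd : ∑ l ∈ N, ∑ a ∈ A', e a l = ∑ a ∈ A', d a := by
      rw [sum_congr (s₁ := A') rfl fun a _ => hd a, sum_comm (s := A')]
      refine sum_subset (filter_subset _ _) fun l hl hl' => sum_eq_zero fun a ha => ?_
      by_contra h0
      exact hl' (mem_filter.2 ⟨hl, a, ha, h0⟩)
    change 2 + ∑ l ∈ N, ∑ a ∈ A', e a l ≤ _ at hsur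
    have hNsub : N ⊆ s.biUnion t ∪ endLabels w c x y := by
      intro l hl
      obtain ⟨hlL, a, ha, hal⟩ := mem_filter.1 hl
      obtain ⟨j, hj, rfl⟩ := mem_image.1 ha
      rw [mem_union]
      by_cases hE : l ∈ endLabels w c x y
      · exact .inr hE
      · exact .inl (mem_biUnion.2 ⟨j, hj, mem_filter.2 ⟨mem_sdiff.2 ⟨hlL, hE⟩, hal⟩⟩)
    have h1 := (card_le_card hNsub).trans (card_union_le _ _)
    have h2 := card_endLabels_le (w := w) (c := c) x y
    have h3 := sum_ends x y A'
    -- An end of the new edge either adds to the demand of `A'` or may block one component, never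
    -- both. The constant 2 in the surplus condition pays for the two ends.
    have h4 : ∀ z, (if z ∈ A' then 1 else 0) + (if z ∈ setC w then 1 else 0) ≤ 1 := by
      intro z
      by_cases hz : z ∈ A'
      · have : z ∉ setC w := fun e => (mem_setC.1 e).2 (hA'A hz)
        simp [hz, this]
      · split_ifs <;> simp
    have h5 := h4 x
    have h6 := h4 y
    omega
  obtain ⟨f, hf, hft⟩ := (all_card_le_biUnion_card_iff_exists_injective t).1 hall
  have hone : ∀ a ∈ setA w, ∀ l, e a l ≠ 0 → e a l = 1 := by
    intro a ha l h0
    have : e a l ≤ 1 := h.left_le_one a ha l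
    omega
  have hex : ∀ l, ∃ a, l ∈ L₀ → (a ∈ setA w ∧ e a l = 1) ∧ ∀ j, f j = l → a = j.1 := by
    intro l
    by_cases hl : l ∈ L₀
    · by_cases hj : ∃ j, f j = l
      · obtain ⟨j, rfl⟩ := hj
        have h1 : j.1 ∈ setA w := by
          by_contra h2
          have h3 : 0 < n j.1 := j.2.pos
          simp [n, h2] at h3
        exact ⟨j.1, fun _ => ⟨⟨h1, hone _ h1 _ (mem_filter.1 (hft j)).2⟩,
          fun j' hj' => by rw [hf hj']⟩⟩
      -- A component not used by Hall's matching omits any of its edges to A; one exists because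
      -- their number is odd.
      · obtain ⟨u, hu, rfl⟩ := mem_image.1 (mem_sdiff.1 hl).1
        obtain ⟨a, ha, ha'⟩ := exists_ne_zero_of_sum_ne_zero (h.odd u hu).pos.ne'
        exact ⟨a, fun _ => ⟨⟨ha, hone a ha _ ha'⟩, fun j hj' => absurd ⟨j, hj'⟩ hj⟩⟩
    · obtain ⟨a⟩ : Nonempty V := ⟨x⟩
      exact ⟨a, fun h => absurd h hl⟩
  choose p hp using hex
  refine ⟨p, fun l hl => (hp l hl).1, fun a ha => ?_⟩
  have h1 : (univ.image fun i : Fin (n a) => f ⟨a, i⟩) ⊆ {l ∈ L₀ | p l = a} := by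
    intro l hl
    obtain ⟨i, -, rfl⟩ := mem_image.1 hl
    have h2 := (mem_filter.1 (hft ⟨a, i⟩)).1
    exact mem_filter.2 ⟨h2, (hp _ h2).2 _ rfl⟩
  have h2 := card_le_card h1
  rw [card_image_of_injective] at h2
  · simp only [card_univ, Fintype.card_fin, n, ha, if_true] at h2
    change d a + _ ≤ _
    omega
  · intro i j hij
    exact eq_of_heq (Sigma.mk.inj (hf hij)).2

theorem Conditions.hasTwoFactor_addOne (h : Conditions w c) (hw : ∀ u v, w u v = w v u)
    {x y : V} (hx : x ∉ setB w) (hy : y ∉ setB w)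
    (hxy : x ∈ setC w → y ∈ setC w → c x ≠ c y) : HasTwoFactor (addOne w x y) := by
  obtain ⟨p, hp, hpd⟩ := h.exists_omission x y
  set L := (setC w).image c with hL
  set L₀ := L \ endLabels w c x y with hL₀
  let F : V → V → ℕ := fun a u =>
    if a ∈ setA w ∧ u ∈ setC w ∧ ¬ (c u ∈ L₀ ∧ p (c u) = a) then w a u else 0
  have hF : ∀ a u, a ∉ setA w ∨ u ∉ setC w → F a u = 0 := fun a u hau => if_neg (by tauto)
  have hclass : ∀ a ∈ setA w, ∀ l, (∑ u ∈ setC w with c u = l, F a u) +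
      (if l ∈ L₀ ∧ p l = a then 1 else 0) = ∑ u ∈ setC w with c u = l, w a u := by
    intro a ha l
    split_ifs with hl
    · have h1 := (hp l hl.1).2
      rw [hl.2] at h1
      rw [h1, sum_eq_zero fun u hu => ?_]
      rw [mem_filter] at hu
      simp only [F]
      rw [if_neg]
      rw [hu.2]
      tauto
    · rw [add_zero]
      refine sum_congr rfl fun u hu => ?_
      rw [mem_filter] at hu
      simp only [F]
      rw [if_pos]
      rw [hu.2]
      exact ⟨ha, hu.1, hl⟩
  have hFC : ∀ a, ∑ u, F a u = ∑ u ∈ setC w, F a u := fun a =>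
    (sum_subset (subset_univ _) fun u _ hu => hF a u (.inr hu)).symm
  have hFA : ∀ u, ∑ a, F a u = ∑ a ∈ setA w, F a u := fun u =>
    (sum_subset (subset_univ _) fun a _ ha => hF a u (.inl ha)).symm
  have hrow : ∀ a ∈ setA w, ∑ u, F a u + #{l ∈ L₀ | p l = a} = ∑ u ∈ setC w, w a u := by
    intro a ha
    rw [hFC, sum_labels (setC w) c (F a), sum_labels (setC w) c (w a),
      ← sum_congr rfl fun l _ => hclass a ha l, sum_add_distrib, ← card_filter]
    congr 2
    ext l
    simp only [mem_filter]
    exact ⟨fun ⟨h1, h2⟩ => ⟨(mem_sdiff.1 h1).1, h1, h2⟩, fun ⟨_, h2⟩ => h2⟩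
  refine h.hasTwoFactor_of_selection hw hx hy ?_ hF ?_ ?_ ?_ ?_
  · intro hxC e
    exact hxy hxC (e ▸ hxC) (by rw [e])
  · intro a u
    simp only [F]
    split_ifs
    · exact le_rfl
    · exact Nat.zero_le _
  · intro a ha
    have h1 := hrow a ha
    have h2 := hpd a ha
    omega
  · intro l
    by_cases hl : l ∈ L
    · have h1 : (∑ u ∈ setC w with c u = l, ∑ a, F a u) + (if l ∈ L₀ then 1 else 0) =
          labelCount w (setB w) (setA w) c l := by
        rw [sum_congr rfl fun u _ => hFA u, sum_comm, labelCount]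
        change _ = ∑ t ∈ setA w, ∑ u ∈ setC w with c u = l, w t u
        rw [← sum_congr rfl fun a ha => hclass a ha l, sum_add_distrib]
        congr 1
        split_ifs with hl₀
        · simp [hl₀, (hp l hl₀).1]
        · simp [hl₀]
      -- Parity: an odd class either loses one edge or contains exactly one end of the new edge, as
      -- the two ends never share a class.
      have h2 : ∑ u ∈ setC w with c u = l, ends x y u = if l ∈ L₀ then 0 else 1 := by
        rw [sum_ends]
        simp only [hL₀, mem_sdiff, hl, true_and, mem_endLabels, mem_filter]
        by_cases h3 : x ∈ setC w ∧ c x = l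
        · have h4 : ¬ (y ∈ setC w ∧ c y = l) := fun h4 =>
            hxy h3.1 h4.1 (h3.2.trans h4.2.symm)
          simp [h3, h4]
        · by_cases h4 : y ∈ setC w ∧ c y = l <;> simp [h3, h4]
      obtain ⟨u, hu, rfl⟩ := mem_image.1 hl
      have h3 := h.odd u hu
      rw [← h1, Nat.odd_iff] at h3
      rw [sum_add_distrib, h2, Nat.even_iff]
      split_ifs at h3 ⊢ <;> omega
    · rw [filter_eq_empty_iff.2 fun u hu (e : c u = l) => hl (e ▸ mem_image_of_mem c hu), sum_empty]
      exact Even.zero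
  -- Each end of xy lies in A or makes one component exempt from omission, so these two counts add
  -- up to 2, the constant of condition 4.
  · have h1 : ∑ a ∈ setA w, #{l ∈ L₀ | p l = a} = #L₀ :=
      (card_eq_sum_card_fiberwise fun l hl => (hp l hl).1).symm
    have h2 : ∑ a ∈ setA w, ∑ u, F a u + #L₀ = ∑ a ∈ setA w, ∑ u ∈ setC w, w a u := by
      rw [← h1, ← sum_add_distrib]
      exact sum_congr rfl hrow
    have h3 := card_sdiff_add_card_eq_card (endLabels_subset (w := w) (c := c) x y)
    have h4 := card_endLabels hxy
    have h5 := h.card_eq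
    have h6 := sum_ends x y (setA w)
    have h7 : ∀ z, z ∉ setB w →
        (if z ∈ setA w then 1 else 0) + (if z ∈ setC w then 1 else 0) = 1 := by
      intro z hz
      by_cases hzA : z ∈ setA w <;> simp [mem_setC, hz, hzA]
    have h8 := h7 x hx
    have h9 := h7 y hy
    rw [sum_add_distrib, h6]
    rw [← hL, ← hL₀] at h3
    rw [← hL] at h5
    omega

/-- Pairs meeting B or lying in one component already have full multiplicity, so every addable edge
falls under `Conditions.hasTwoFactor_addOne`. -/
theorem Conditions.isMaximal (h : Conditions w c) (hw : ∀ u v, w u v = w v u) :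
    IsMaximal w := by
  refine ⟨h.isBarrier.not_hasTwoFactor, fun x y hlt => ?_⟩
  have hB : ∀ x y, w x y < (if x = y then 1 else 2) → x ∉ setB w := by
    intro x y hlt hx
    rw [mem_setB] at hx
    split_ifs at hlt with hxy
    · subst hxy
      omega
    · rw [hx.2 y (Ne.symm hxy)] at hlt
      omega
  refine h.hasTwoFactor_addOne hw (hB x y hlt) (hB y x ?_) ?_
  · rw [hw]
    simpa only [eq_comm] using hlt
  · intro hx hy hc
    split_ifs at hlt with hxy
    · subst hxy
      exact (mem_setC.1 hx).2 (mem_setA.2 (by omega))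
    · rw [h.eq_two x hx y hy hxy hc] at hlt
      omega

end MultMatrix

/-! ### From multigraphs to multiplicity matrices -/

namespace Graph

open Finset MultMatrix

variable {α β : Type*} {G : Graph α β}

theorem linkSet_comm (G : Graph α β) (x y : α) : G.linkSet x y = G.linkSet y x := by
  ext e; exact G.isLink_comm

theorem finite_linkSet (hG : G.edgeSet.Finite) (x y : α) : (G.linkSet x y).Finite :=
  hG.subset fun _ he => IsLink.edge_mem he

theorem ncard_biUnion_finset {ι β : Type*} (s : Finset ι) {t : ι → Set β}
    (ht : ∀ i ∈ s, (t i).Finite) (hd : ∀ i ∈ s, ∀ j ∈ s, i ≠ j → Disjoint (t i) (t j)) :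
    (⋃ i ∈ s, t i).ncard = ∑ i ∈ s, (t i).ncard := by
  have h := s.finite_toSet.ncard_biUnion (s := t) ht fun i hi j hj hij => hd i hi j hj hij
  rw [finsum_mem_coe_finset] at h
  exact h

/-- The matrix of edge multiplicities on the vertex set `V`. -/
noncomputable def mult (G : Graph α β) (V : Set α) (u v : V) : ℕ := (G.linkSet u v).ncard

theorem mult_comm (G : Graph α β) (V : Set α) (u v : V) : G.mult V u v = G.mult V v u := by
  rw [mult, mult, linkSet_comm]

theorem mult_eq_zero (hG : G.edgeSet.Finite) {V : Set α} {u v : V} :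
    G.mult V u v = 0 ↔ ¬ G.Adj u v := by
  rw [mult, Set.ncard_eq_zero (finite_linkSet hG _ _), Set.eq_empty_iff_forall_notMem]
  simp [Adj, linkSet]

section

variable {V : Set α} [Fintype V] [DecidableEq V]

theorem degree_eq (hE : G.edgeSet.Finite) (hV : G.vertexSet = V) (x : V) :
    G.degree x = ∑ v, G.mult V x v + G.mult V x x := by
  have h1 : {e | G.IsNonloopAt e x} = ⋃ v ∈ univ.erase x, G.linkSet x v := by
    ext e
    simp only [Set.mem_iUnion, mem_erase, mem_univ, and_true, exists_prop, linkSet,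
      Set.mem_ofPred_eq, IsNonloopAt]
    constructor
    · rintro ⟨y, hy, he⟩
      exact ⟨⟨y, hV ▸ he.right_mem⟩, fun h => hy (congrArg Subtype.val h), he⟩
    · rintro ⟨v, hv, he⟩
      exact ⟨v, fun h => hv (Subtype.ext h), he⟩
  rw [degree, h1, ncard_biUnion_finset]
  · rw [← sum_erase_add _ _ (mem_univ x)]
    change ∑ v ∈ univ.erase x, G.mult V x v + 2 * G.mult V x x = _
    omega
  · intro v _
    exact finite_linkSet hE _ _
  · intro u _ v _ huv
    rw [Set.disjoint_left]
    intro e he he'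
    exact huv (Subtype.ext (IsLink.right_unique he he'))

theorem hasFactor_two_iff (hE : G.edgeSet.Finite) (hV : G.vertexSet = V) :
    G.HasFactor 2 ↔ HasTwoFactor (G.mult V) := by
  constructor
  · rintro ⟨F, hF, hdeg⟩
    have hFE : F.edgeSet.Finite := hE.subset (IsSubgraph.edgeSet_mono hF.le)
    have hFV : F.vertexSet = V := hF.vertexSet_eq.trans hV
    refine ⟨F.mult V, F.mult_comm V, ?_, ?_⟩
    · intro u v
      exact Set.ncard_le_ncard (fun e he => IsLink.mono hF.le he) (finite_linkSet hE _ _)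
    · intro u
      rw [← degree_eq hFE hFV]
      exact hdeg u (hFV ▸ u.2)
  · rintro ⟨m, hm, hmw, hdeg⟩
    have hsub : ∀ (L : Set β) (n : ℕ), ∃ t : Set β, t ⊆ L ∧ (n ≤ L.ncard → t.ncard = n) := by
      intro L n
      by_cases hn : n ≤ L.ncard
      · obtain ⟨t, ht, ht'⟩ := Set.exists_subset_card_eq hn
        exact ⟨t, ht, fun _ => ht'⟩
      · exact ⟨∅, Set.empty_subset _, fun h => absurd h hn⟩
    -- The chosen subset depends only on the edge set and the number, not on the ordered pair of
    -- ends, so the selection `X` below is symmetric.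
    choose t ht htn using hsub
    let X : V → V → Set β := fun u v => t (G.linkSet u v) (m u v)
    let F := G.restrict {e | ∃ u v : V, e ∈ X u v}
    have hFX : ∀ u v : V, F.linkSet u v = X u v := by
      intro u v
      ext e
      constructor
      · rintro ⟨⟨u', v', he⟩, hl⟩
        have hl' : G.IsLink e u' v' := ht _ _ he
        rcases hl'.eq_and_eq_or_eq_and_eq hl with ⟨h1, h2⟩ | ⟨h1, h2⟩
        · have h1 := Subtype.ext h1
          have h2 := Subtype.ext h2
          rwa [← h1, ← h2]
        · have h1 := Subtype.ext h1
          have h2 := Subtype.ext h2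
          simp only [X]
          rw [linkSet_comm, hm, ← h1, ← h2]
          exact he
      · intro he
        exact ⟨⟨u, v, he⟩, ht _ _ he⟩
    have hFm : ∀ u v, F.mult V u v = m u v := by
      intro u v
      rw [mult, hFX]
      exact htn _ _ (hmw u v)
    have hle : F ≤ G := restrict_le
    refine ⟨F, ⟨hle, rfl⟩, fun x hx => ?_⟩
    have hxV : x ∈ V := hV ▸ hx
    have h1 := degree_eq (G := F) (hE.subset (IsSubgraph.edgeSet_mono hle)) hV ⟨x, hxV⟩
    rw [h1, hFm, sum_congr rfl fun v _ => hFm _ v]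
    exact hdeg _

end

theorem ncard_linkSet_addEdge (hE : G.edgeSet.Finite) {x y : α} (hx : x ∈ G.vertexSet)
    (hy : y ∈ G.vertexSet) (u v : α) [Decidable ((u = x ∧ v = y) ∨ (u = y ∧ v = x))] :
    ((G.addEdge x y hx hy).linkSet u v).ncard =
      (G.linkSet u v).ncard + if (u = x ∧ v = y) ∨ (u = y ∧ v = x) then 1 else 0 := by
  have hinj : Function.Injective (some : β → Option β) := Option.some_injective _
  split_ifs with h
  · have h1 : (G.addEdge x y hx hy).linkSet u v = insert none (some '' G.linkSet u v) := by
      ext (_ | e)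
      · simp only [Set.mem_insert_iff, true_or, iff_true]
        exact h
      · simp only [Set.mem_insert_iff, reduceCtorEq, false_or, hinj.mem_set_image]
        exact Iff.rfl
    rw [h1, Set.ncard_insert_of_notMem (by simp) ((finite_linkSet hE _ _).image _),
      Set.ncard_image_of_injective _ hinj]
  · have h1 : (G.addEdge x y hx hy).linkSet u v = some '' G.linkSet u v := by
      ext (_ | e)
      · simp only [Set.mem_image, reduceCtorEq, and_false, exists_false, iff_false]
        exact h
      · rw [hinj.mem_set_image]
        exact Iff.rfl
    rw [h1, Set.ncard_image_of_injective _ hinj, add_zero]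

theorem finite_edgeSet_addEdge (hE : G.edgeSet.Finite) {x y : α} (hx : x ∈ G.vertexSet)
    (hy : y ∈ G.vertexSet) : (G.addEdge x y hx hy).edgeSet.Finite := by
  refine ((hE.image some).insert none).subset ?_
  rintro (_ | e) he
  · exact Set.mem_insert _ _
  · obtain ⟨u, v, huv⟩ := exists_isLink_of_mem_edgeSet he
    have huv : G.IsLink e u v := huv
    exact Set.mem_insert_of_mem _ ⟨e, huv.edge_mem, rfl⟩

theorem MemM2.addEdge_iff (hG : G.MemM2) {x y : α} (hx : x ∈ G.vertexSet) (hy : y ∈ G.vertexSet)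
    [Decidable (x = y)] :
    (G.addEdge x y hx hy).MemM2 ↔ (G.linkSet x y).ncard < if x = y then 1 else 2 := by
  classical
  have key := ncard_linkSet_addEdge hG.finite_edgeSet hx hy
  constructor
  · intro h
    have h1 := key x y
    rw [if_pos (.inl ⟨rfl, rfl⟩)] at h1
    split_ifs with hxy
    · subst hxy
      have h2 : ((G.addEdge x x hx hy).linkSet x x).ncard ≤ 1 := h.ncard_loopSet_le x
      omega
    · have := h.ncard_linkSet_le x y hxy
      omega
  · intro h
    refine ⟨hG.finite_vertexSet, finite_edgeSet_addEdge hG.finite_edgeSet hx hy, ?_, ?_⟩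
    · intro u v huv
      have h1 := hG.ncard_linkSet_le u v huv
      rw [key]
      split_ifs with h2
      · rcases h2 with ⟨rfl, rfl⟩ | ⟨rfl, rfl⟩
        · rw [if_neg huv] at h
          omega
        · rw [if_neg huv.symm, linkSet_comm] at h
          omega
      · omega
    · intro u
      have h1 : (G.linkSet u u).ncard ≤ 1 := hG.ncard_loopSet_le u
      change ((G.addEdge x y hx hy).linkSet u u).ncard ≤ 1
      rw [key]
      split_ifs with h2
      · have h3 : u = x ∧ u = y := by tauto
        obtain ⟨rfl, rfl⟩ := h3
        rw [if_pos rfl] at h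
        omega
      · omega

theorem MemM2.isMaximal_iff (hG : G.MemM2) {V : Set α} [Fintype V] [DecidableEq V]
    (hV : G.vertexSet = V) : G.IsMaximalWithoutTwoFactor ↔ IsMaximal (G.mult V) := by
  classical
  subst hV
  have hmul : ∀ (x y : G.vertexSet),
      (G.addEdge x y x.2 y.2).mult G.vertexSet = addOne (G.mult G.vertexSet) x y := by
    intro x y
    funext u v
    rw [mult, ncard_linkSet_addEdge hG.finite_edgeSet, addOne, mult]
    simp only [Subtype.ext_iff]
  have hfac : ∀ (x y : G.vertexSet), (G.addEdge x y x.2 y.2).HasFactor 2 ↔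
      HasTwoFactor (addOne (G.mult G.vertexSet) x y) := by
    intro x y
    rw [← hmul]
    exact hasFactor_two_iff (finite_edgeSet_addEdge hG.finite_edgeSet x.2 y.2) rfl
  have hcap : ∀ (x y : G.vertexSet), (G.addEdge x y x.2 y.2).MemM2 ↔
      G.mult G.vertexSet x y < if x = y then 1 else 2 := by
    intro x y
    rw [hG.addEdge_iff, mult]
    simp only [Subtype.ext_iff]
  constructor
  · intro h
    refine ⟨fun h1 => h.not_hasFactor ((hasFactor_two_iff hG.finite_edgeSet rfl).2 h1), ?_⟩
    intro x y hxy
    exact (hfac x y).1 (h.hasFactor_addEdge x y x.2 y.2 ((hcap x y).2 hxy))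
  · intro h
    refine ⟨hG, fun h1 => h.not_hasTwoFactor ((hasFactor_two_iff hG.finite_edgeSet rfl).1 h1), ?_⟩
    intro x y hx hy hxy
    exact (hfac ⟨x, hx⟩ ⟨y, hy⟩).2 (h.hasTwoFactor_addOne _ _ ((hcap ⟨x, hx⟩ ⟨y, hy⟩).1 hxy))

end Graph

/-! ### Translating the conditions between multigraphs and matrices -/

namespace Graph

open Finset MultMatrix

variable {α β : Type*} {G : Graph α β} {V : Set α}

/-- Disjointness keeps an edge from being counted from both of its ends. -/
theorem numEdgesBetween_image (hE : G.edgeSet.Finite) {X Y : Finset V} (hXY : Disjoint X Y) :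
    G.numEdgesBetween (Subtype.val '' (X : Set V)) (Subtype.val '' (Y : Set V)) =
      ∑ x ∈ X, ∑ y ∈ Y, G.mult V x y := by
  have h1 : G.edgesBetween (Subtype.val '' (X : Set V)) (Subtype.val '' (Y : Set V)) =
      ⋃ p ∈ X ×ˢ Y, G.linkSet p.1 p.2 := by
    ext e
    simp only [Set.mem_iUnion, mem_product, exists_prop, linkSet, Set.mem_ofPred_eq, edgesBetween]
    constructor
    · rintro ⟨_, ⟨x, hx, rfl⟩, _, ⟨y, hy, rfl⟩, he⟩
      exact ⟨(x, y), ⟨hx, hy⟩, he⟩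
    · rintro ⟨⟨x, y⟩, ⟨hx, hy⟩, he⟩
      exact ⟨x, ⟨x, hx, rfl⟩, y, ⟨y, hy, rfl⟩, he⟩
  rw [numEdgesBetween, h1, ncard_biUnion_finset, sum_product]
  · rfl
  · intro p _
    exact finite_linkSet hE _ _
  · rintro ⟨x, y⟩ hp ⟨x', y'⟩ hp' hne
    rw [mem_product] at hp hp'
    rw [Set.disjoint_left]
    intro e he he'
    rcases IsLink.eq_and_eq_or_eq_and_eq he he' with ⟨h2, h3⟩ | ⟨h2, h3⟩
    · exact hne (Prod.ext (Subtype.ext h2) (Subtype.ext h3))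
    · have h2 : x = y' := Subtype.ext h2
      exact disjoint_left.1 hXY hp.1 (h2 ▸ hp'.2)

theorem ncard_image_val (X : Finset V) : (Subtype.val '' (X : Set V)).ncard = #X := by
  rw [Set.ncard_image_of_injective _ Subtype.val_injective, Set.ncard_coe_finset]

variable [Fintype V] [DecidableEq V] {ι : Type*}

theorem image_setA (hE : G.edgeSet.Finite) (hV : G.vertexSet = V) :
    Subtype.val '' (setA (G.mult V) : Set V) = G.partA := by
  have h : ∀ u : V, u ∈ setA (G.mult V) ↔ G.loopSet u = ∅ := by
    intro u
    rw [mem_setA, mult, Set.ncard_eq_zero (finite_linkSet hE _ _)]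
    exact Iff.rfl
  ext x
  constructor
  · rintro ⟨u, hu, rfl⟩
    exact ⟨hV ▸ u.2, (h u).1 hu⟩
  · rintro ⟨hx, hx'⟩
    exact ⟨⟨x, hV ▸ hx⟩, (h _).2 hx', rfl⟩

theorem image_setB (hE : G.edgeSet.Finite) (hV : G.vertexSet = V) :
    Subtype.val '' (setB (G.mult V) : Set V) = G.partB := by
  have h : ∀ u : V, u ∈ setB (G.mult V) ↔ (G.loopSet u).Nonempty ∧
      ∀ y ∈ G.vertexSet, y ≠ u → (G.linkSet u y).ncard = 2 := by
    intro u
    rw [mem_setB, mult, Ne, Set.ncard_eq_zero (finite_linkSet hE _ _),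
      ← Ne, ← Set.nonempty_iff_ne_empty]
    refine and_congr Iff.rfl ⟨fun h y hy hne => ?_, fun h v hv => ?_⟩
    · exact h ⟨y, hV ▸ hy⟩ fun e => hne (congrArg Subtype.val e)
    · exact h v (hV ▸ v.2) fun e => hv (Subtype.ext e)
  ext x
  constructor
  · rintro ⟨u, hu, rfl⟩
    exact ⟨hV ▸ u.2, (h u).1 hu⟩
  · rintro ⟨hx, hx'⟩
    exact ⟨⟨x, hV ▸ hx⟩, (h _).2 hx', rfl⟩

theorem image_setC (hE : G.edgeSet.Finite) (hV : G.vertexSet = V) :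
    Subtype.val '' (setC (G.mult V) : Set V) = G.partC := by
  rw [partC, ← image_setA hE hV, ← image_setB hE hV, ← Set.image_union]
  ext x
  constructor
  · rintro ⟨u, hu, rfl⟩
    have hu := mem_setC.1 hu
    refine ⟨hV ▸ u.2, ?_⟩
    rintro ⟨v, hv, hvu⟩
    have hvu := Subtype.ext hvu
    subst hvu
    exact hv.elim hu.2 hu.1
  · rintro ⟨hx, hx'⟩
    refine ⟨⟨x, hV ▸ hx⟩, mem_setC.2 ⟨fun h => ?_, fun h => ?_⟩, rfl⟩
    · exact hx' ⟨_, .inr h, rfl⟩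
    · exact hx' ⟨_, .inl h, rfl⟩

/-- `c` labels the components of the subgraph induced by `G.partC`. -/
def IsComponentLabelling (G : Graph α β) (c : V → ι) : Prop :=
  ∀ u ∈ setC (G.mult V), ∀ v ∈ setC (G.mult V),
    c u = c v ↔ Relation.ReflTransGen (G.induce G.partC).Adj u v

theorem induce_adj_iff {X : Set α} {x y : α} :
    (G.induce X).Adj x y ↔ G.Adj x y ∧ x ∈ X ∧ y ∈ X :=
  ⟨fun ⟨e, h⟩ => ⟨⟨e, h.1⟩, h.2⟩, fun ⟨⟨e, h⟩, h'⟩ => ⟨e, h, h'⟩⟩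

theorem exists_isComponentLabelling (G : Graph α β) (V : Set α) [Fintype V] [DecidableEq V] :
    ∃ c : V → V, G.IsComponentLabelling c := by
  have hsymm : Std.Symm (G.induce G.partC).Adj := ⟨fun _ _ h => h.symm⟩
  let s : Setoid V := ⟨fun u v => Relation.ReflTransGen (G.induce G.partC).Adj u v,
    fun _ => .refl, fun h => Relation.ReflTransGen.stdSymm.symm _ _ h,
    fun h h' => h.trans h'⟩
  refine ⟨fun u => (Quotient.mk s u).out, fun u _ v _ => ?_⟩
  rw [Quotient.out_inj, Quotient.eq]
  rfl

/-- The labels come from a barrier, not from `G`, yet they must be the components: equal labels give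
adjacent or equal vertices, and no edge joins different labels. -/
theorem _root_.MultMatrix.Conditions.isComponentLabelling [DecidableEq ι] (hE : G.edgeSet.Finite)
    (hV : G.vertexSet = V) {c : V → ι} (h : Conditions (G.mult V) c) :
    G.IsComponentLabelling c := by
  intro u hu v hv
  have hC : ∀ w : V, w ∈ setC (G.mult V) ↔ (w : α) ∈ G.partC := by
    intro w
    rw [← image_setC hE hV, Subtype.val_injective.mem_set_image]
    rfl
  constructor
  · intro hc
    by_cases huv : u = v
    · rw [huv]
    · refine .single (induce_adj_iff.2 ⟨?_, (hC u).1 hu, (hC v).1 hv⟩)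
      by_contra hadj
      rw [← mult_eq_zero hE, h.eq_two u hu v hv huv hc] at hadj
      omega
  · intro hr
    have key : ∀ x : α, Relation.ReflTransGen (G.induce G.partC).Adj u x →
        ∀ hx : x ∈ V, c u = c ⟨x, hx⟩ := by
      intro x hx
      induction hx with
      | refl => intro _; rfl
      | @tail y z _ hyz ih =>
        intro hz
        obtain ⟨h1, h2, h3⟩ := induce_adj_iff.1 hyz
        have hy : y ∈ V := hV ▸ h1.left_mem
        rw [ih hy]
        by_contra hne
        exact (mult_eq_zero hE (u := ⟨y, hy⟩) (v := ⟨z, hz⟩)).1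
          (h.eq_zero _ ((hC _).2 h2) _ ((hC _).2 h3) hne) h1
    exact key v hr v.2

/-- The vertices of `G.partC` with label `l`. -/
def labelClass (G : Graph α β) (c : V → ι) (l : ι) : Set α :=
  Subtype.val '' ({u ∈ setC (G.mult V) | c u = l} : Set V)

theorem labelClass_eq [DecidableEq ι] (c : V → ι) (l : ι) : G.labelClass c l =
    Subtype.val '' (({u ∈ setC (G.mult V) | c u = l} : Finset V) : Set V) := by
  rw [labelClass, coe_filter]

theorem mem_labelClass {c : V → ι} {l : ι} {u : V} :
    (u : α) ∈ G.labelClass c l ↔ u ∈ setC (G.mult V) ∧ c u = l := by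
  rw [labelClass, Subtype.val_injective.mem_set_image]
  rfl

variable [DecidableEq ι]

theorem labelClass_injOn (c : V → ι) :
    Set.InjOn (G.labelClass c) ((setC (G.mult V)).image c : Finset ι) := by
  intro l hl l' _ hll
  obtain ⟨u, hu, rfl⟩ := mem_image.1 (mem_coe.1 hl)
  have h1 : (u : α) ∈ G.labelClass c (c u) := mem_labelClass.2 ⟨hu, rfl⟩
  rw [hll] at h1
  exact (mem_labelClass.1 h1).2

theorem IsComponentLabelling.componentsC_eq (hE : G.edgeSet.Finite) (hV : G.vertexSet = V)
    {c : V → ι} (hc : G.IsComponentLabelling c) :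
    G.componentsC = G.labelClass c '' ((setC (G.mult V)).image c : Finset ι) := by
  have hC := image_setC hE hV
  have key : ∀ u ∈ setC (G.mult V),
      {y | Relation.ReflTransGen (G.induce G.partC).Adj u y} = G.labelClass c (c u) := by
    intro u hu
    have huC : (u : α) ∈ G.partC := hC ▸ ⟨u, hu, rfl⟩
    ext y
    constructor
    · intro hy
      have hyC : y ∈ G.partC := by
        rcases Relation.ReflTransGen.cases_tail hy with h1 | ⟨z, -, h1⟩
        · rw [h1]
          exact huC
        · exact (induce_adj_iff.1 h1).2.2
      rw [← hC] at hyC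
      obtain ⟨v, hv, rfl⟩ := hyC
      exact mem_labelClass.2 ⟨hv, ((hc u hu v hv).2 hy).symm⟩
    · rintro ⟨v, ⟨hv, hvu⟩, rfl⟩
      exact (hc u hu v hv).1 hvu.symm
  ext S
  constructor
  · rintro ⟨x, hx, rfl⟩
    have hx : x ∈ G.partC := hx
    rw [← hC] at hx
    obtain ⟨u, hu, rfl⟩ := hx
    exact ⟨c u, mem_image_of_mem c hu, (key u hu).symm⟩
  · rintro ⟨l, hl, rfl⟩
    obtain ⟨u, hu, rfl⟩ := mem_image.1 (mem_coe.1 hl)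
    exact ⟨u, (hC ▸ ⟨u, hu, rfl⟩ : (u : α) ∈ G.partC), (key u hu).symm⟩

theorem disjoint_setA_filter (w : V → V → ℕ) {A' : Finset V} (hA' : A' ⊆ setA w) (c : V → ι)
    (l : ι) : Disjoint A' {u ∈ setC w | c u = l} := by
  rw [disjoint_left]
  intro u hu hu'
  exact (mem_setC.1 (mem_filter.1 hu').1).2 (hA' hu)

theorem numEdgesBetween_labelClass (hE : G.edgeSet.Finite) {A' : Finset V}
    (hA' : A' ⊆ setA (G.mult V)) (c : V → ι) (l : ι) :
    G.numEdgesBetween (Subtype.val '' (A' : Set V)) (G.labelClass c l) =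
      ∑ a ∈ A', ∑ u ∈ setC (G.mult V) with c u = l, G.mult V a u := by
  rw [labelClass_eq, numEdgesBetween_image hE (disjoint_setA_filter _ hA' c l)]

theorem numEdgesBetween_partA_labelClass (hE : G.edgeSet.Finite) (hV : G.vertexSet = V)
    (c : V → ι) (l : ι) :
    G.numEdgesBetween G.partA (G.labelClass c l) =
      labelCount (G.mult V) (setB (G.mult V)) (setA (G.mult V)) c l := by
  rw [← image_setA hE hV, numEdgesBetween_labelClass hE Subset.rfl]
  rfl

theorem numEdgesBetween_partA_partC (hE : G.edgeSet.Finite) (hV : G.vertexSet = V) :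
    G.numEdgesBetween G.partA G.partC =
      ∑ a ∈ setA (G.mult V), ∑ u ∈ setC (G.mult V), G.mult V a u := by
  rw [← image_setA hE hV, ← image_setC hE hV, numEdgesBetween_image hE]
  rw [disjoint_left]
  intro u hu hu'
  exact (mem_setC.1 hu').2 hu

theorem ncard_partA (hE : G.edgeSet.Finite) (hV : G.vertexSet = V) :
    G.partA.ncard = #(setA (G.mult V)) := by
  rw [← image_setA hE hV, ncard_image_val]

theorem ncard_partB (hE : G.edgeSet.Finite) (hV : G.vertexSet = V) :
    G.partB.ncard = #(setB (G.mult V)) := by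
  rw [← image_setB hE hV, ncard_image_val]

theorem IsComponentLabelling.ncard_componentsC (hE : G.edgeSet.Finite) (hV : G.vertexSet = V)
    {c : V → ι} (hc : G.IsComponentLabelling c) :
    G.componentsC.ncard = #((setC (G.mult V)).image c) := by
  rw [hc.componentsC_eq hE hV, (labelClass_injOn c).ncard_image, Set.ncard_coe_finset]

/-- Conditions 1 to 5 of the theorem. -/
def StructureConditions (G : Graph α β) : Prop :=
  G.IsIndependent G.partA ∧
  (∀ S ∈ G.componentsC, G.IsDoublyComplete S) ∧
  (∀ S ∈ G.componentsC, G.IsMatching (G.edgesBetween G.partA S) ∧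
    Odd (G.numEdgesBetween G.partA S)) ∧
  2 * G.partA.ncard + G.componentsC.ncard =
    2 * G.partB.ncard + G.numEdgesBetween G.partA G.partC + 2 ∧
  (∀ (A' : Finset α) (C' : Finset (Set α)), (A' : Set α) ⊆ G.partA → A'.Nonempty →
    (C' : Set (Set α)) ⊆ G.componentsC →
    2 + ∑ S ∈ C', G.numEdgesBetween (A' : Set α) S ≤ 2 * A'.card + C'.card)

theorem StructureConditions.conditions (hE : G.edgeSet.Finite) (hV : G.vertexSet = V)
    {c : V → ι} (hc : G.IsComponentLabelling c) (h : G.StructureConditions) :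
    Conditions (G.mult V) c := by
  classical
  obtain ⟨h1, h2, h3, h4, h5⟩ := h
  have hA := image_setA hE hV
  have hC := image_setC hE hV
  have hcomp := hc.componentsC_eq hE hV
  have hmem : ∀ u ∈ setC (G.mult V), G.labelClass c (c u) ∈ G.componentsC := by
    intro u hu
    rw [hcomp]
    exact ⟨c u, mem_image_of_mem c hu, rfl⟩
  have hAmem : ∀ u ∈ setA (G.mult V), (u : α) ∈ G.partA := fun u hu => hA ▸ ⟨u, hu, rfl⟩
  -- Both matching bounds at once: if one side is a single vertex, all the edges counted share that
  -- end.
  have hle : ∀ l ∈ (setC (G.mult V)).image c, ∀ X Y : Finset V, X ⊆ setA (G.mult V) →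
      Y ⊆ {u ∈ setC (G.mult V) | c u = l} → (∃ x : V, X = {x} ∨ Y = {x}) →
      ∑ a ∈ X, ∑ u ∈ Y, G.mult V a u ≤ 1 := by
    rintro l hl X Y hX hY ⟨x, hx⟩
    have hl' : G.labelClass c l ∈ G.componentsC := hcomp ▸ ⟨l, hl, rfl⟩
    rw [← numEdgesBetween_image hE ((disjoint_setA_filter _ hX c l).mono_right hY)]
    have hinc : ∀ e ∈ G.edgesBetween (Subtype.val '' (X : Set V)) (Subtype.val '' (Y : Set V)),
        e ∈ G.edgesBetween G.partA (G.labelClass c l) ∧ G.Inc e x := by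
      rintro e ⟨_, ⟨a, ha, rfl⟩, _, ⟨u, hu, rfl⟩, he⟩
      refine ⟨⟨a, hAmem a (hX ha), u, ?_, he⟩, ?_⟩
      · exact mem_labelClass.2 (mem_filter.1 (hY hu))
      · rcases hx with rfl | rfl
        · rw [mem_coe, mem_singleton] at ha
          exact ha ▸ he.inc_left
        · rw [mem_coe, mem_singleton] at hu
          exact hu ▸ he.inc_right
    have hfin : (G.edgesBetween (Subtype.val '' (X : Set V))
        (Subtype.val '' (Y : Set V))).Finite := hE.subset fun e he => (hinc e he).2.edge_mem
    rw [numEdgesBetween, Set.ncard_le_one hfin]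
    intro e he f hf
    exact (h3 _ hl').1.2.2 e (hinc e he).1 f (hinc f hf).1 x (hinc e he).2 (hinc f hf).2
  refine ⟨?_, ?_, ?_, ?_, ?_, ?_, ?_, ?_⟩
  · intro u hu v hv
    rw [mult_eq_zero hE]
    exact h1 u (hAmem u hu) v (hAmem v hv)
  · intro u hu v hv hne
    rw [mult_eq_zero hE]
    intro hadj
    exact hne ((hc u hu v hv).2 (.single (induce_adj_iff.2
      ⟨hadj, hC ▸ ⟨u, hu, rfl⟩, hC ▸ ⟨v, hv, rfl⟩⟩)))
  · intro u hu v hv huv hcuv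
    exact (h2 _ (hmem u hu)).2 u (mem_labelClass.2 ⟨hu, rfl⟩) v
      (mem_labelClass.2 ⟨hv, hcuv.symm⟩) fun e => huv (Subtype.ext e)
  · intro a ha l
    by_cases hl : l ∈ (setC (G.mult V)).image c
    · have := hle l hl {a} _ (singleton_subset_iff.2 ha) Subset.rfl ⟨a, .inl rfl⟩
      rwa [sum_singleton] at this
    · rw [filter_eq_empty_iff.2 fun u hu (e : c u = l) => hl (e ▸ mem_image_of_mem c hu),
        sum_empty]
      exact Nat.zero_le _
  · intro u hu
    have := hle (c u) (mem_image_of_mem c hu) _ {u} Subset.rfl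
      (singleton_subset_iff.2 (mem_filter.2 ⟨hu, rfl⟩)) ⟨u, .inr rfl⟩
    simpa only [sum_singleton] using this
  · intro u hu
    rw [← numEdgesBetween_partA_labelClass hE hV]
    exact (h3 _ (hmem u hu)).2
  · rw [ncard_partA hE hV, ncard_partB hE hV, hc.ncard_componentsC hE hV,
      numEdgesBetween_partA_partC hE hV] at h4
    exact h4
  · intro A' hA' hne L' hL'
    have hinj := (labelClass_injOn (G := G) c).mono (coe_subset.2 hL')
    have := h5 (A'.map (Function.Embedding.subtype _)) (L'.image (G.labelClass c)) (by
      rw [coe_map, ← hA]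
      exact Set.image_mono (coe_subset.2 hA')) (hne.map) (by
      rw [coe_image, hcomp]
      exact Set.image_mono (coe_subset.2 hL'))
    rw [sum_image hinj, card_image_of_injOn hinj, card_map, coe_map] at this
    refine le_trans (le_of_eq ?_) this
    congr 1
    exact sum_congr rfl fun l _ => (numEdgesBetween_labelClass hE hA' c l).symm

theorem _root_.MultMatrix.Conditions.structureConditions (hG : G.MemM2) (hV : G.vertexSet = V)
    {c : V → ι} (h : Conditions (G.mult V) c) : G.StructureConditions := by
  classical
  have hE := hG.finite_edgeSet
  have hc := h.isComponentLabelling hE hV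
  have hA := image_setA hE hV
  have hcomp := hc.componentsC_eq hE hV
  refine ⟨?_, ?_, ?_, ?_, ?_⟩
  · rw [IsIndependent, ← hA]
    rintro _ ⟨u, hu, rfl⟩ _ ⟨v, hv, rfl⟩
    exact (mult_eq_zero hE).1 (h.independent u hu v hv)
  · rw [hcomp]
    rintro _ ⟨l, -, rfl⟩
    constructor
    · rintro _ ⟨u, ⟨hu, -⟩, rfl⟩
      have h1 := hG.ncard_loopSet_le u
      have h2 : G.mult V u u ≠ 0 := fun e => (mem_setC.1 hu).2 (mem_setA.2 e)
      have h3 : G.mult V u u = (G.loopSet u).ncard := rfl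
      omega
    · rintro _ ⟨u, ⟨hu, hul⟩, rfl⟩ _ ⟨v, ⟨hv, hvl⟩, rfl⟩ hne
      exact h.eq_two u hu v hv (fun e => hne (congrArg _ e)) (hul.trans hvl.symm)
  · rw [hcomp]
    rintro _ ⟨l, hl, rfl⟩
    have hne : ∀ a ∈ setA (G.mult V), ∀ u ∈ setC (G.mult V), (a : α) ≠ u := by
      intro a ha u hu e
      exact (mem_setC.1 hu).2 (Subtype.ext e ▸ ha)
    have hex : ∀ e ∈ G.edgesBetween G.partA (G.labelClass c l), ∃ a ∈ setA (G.mult V),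
        ∃ u, (u ∈ setC (G.mult V) ∧ c u = l) ∧ G.IsLink e a u := by
      rw [← hA]
      rintro e ⟨_, ⟨a, ha, rfl⟩, _, ⟨u, hu, rfl⟩, he⟩
      exact ⟨a, ha, u, hu, he⟩
    refine ⟨⟨?_, ?_, ?_⟩, ?_⟩
    · intro e he
      obtain ⟨a, -, u, -, he⟩ := hex e he
      exact he.edge_mem
    · intro e he x hx
      obtain ⟨a, ha, u, hu, he⟩ := hex e he
      exact hne a ha u hu.1 ((hx.eq_of_inc he.inc_left).symm.trans (hx.eq_of_inc he.inc_right))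
    · intro e he f hf x hex' hfx
      obtain ⟨a, ha, u, hu, he⟩ := hex e he
      obtain ⟨b, hb, v, hv, hf⟩ := hex f hf
      have hone : ∀ X Y : Finset V, ∑ x ∈ X, ∑ y ∈ Y, G.mult V x y ≤ 1 → Disjoint X Y →
          a ∈ X → b ∈ X → u ∈ Y → v ∈ Y → e = f := by
        intro X Y h1 hd haX hbX huY hvY
        have hfin : (G.edgesBetween (Subtype.val '' (X : Set V))
            (Subtype.val '' (Y : Set V))).Finite := hE.subset fun e ⟨_, _, _, _, h⟩ => h.edge_mem
        rw [← numEdgesBetween_image hE hd, numEdgesBetween, Set.ncard_le_one hfin] at h1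
        exact h1 e ⟨a, ⟨a, haX, rfl⟩, u, ⟨u, huY, rfl⟩, he⟩ f
          ⟨b, ⟨b, hbX, rfl⟩, v, ⟨v, hvY, rfl⟩, hf⟩
      rcases hex'.eq_or_eq_of_isLink he with h1 | h1 <;>
        rcases hfx.eq_or_eq_of_isLink hf with h2 | h2
      · have hab : a = b := Subtype.ext (h1.symm.trans h2)
        subst hab
        refine hone {a} {u ∈ setC (G.mult V) | c u = l} ?_ ?_ (mem_singleton_self a)
          (mem_singleton_self a) (mem_filter.2 hu) (mem_filter.2 hv)
        · rw [sum_singleton]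
          exact h.left_le_one a ha l
        · exact disjoint_setA_filter _ (singleton_subset_iff.2 ha) c l
      · exact absurd (h1.symm.trans h2) (hne a ha v hv.1)
      · exact absurd (h2.symm.trans h1) (hne b hb u hu.1)
      · have huv : u = v := Subtype.ext (h1.symm.trans h2)
        subst huv
        refine hone (setA (G.mult V)) {u} ?_ ?_ ha hb (mem_singleton_self u)
          (mem_singleton_self u)
        · simpa only [sum_singleton] using h.right_le_one u hu.1
        · rw [disjoint_singleton_right]
          exact (mem_setC.1 hu.1).2
    · obtain ⟨u, hu, rfl⟩ := mem_image.1 (mem_coe.1 hl)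
      rw [numEdgesBetween_partA_labelClass hE hV]
      exact h.odd u hu
  · rw [ncard_partA hE hV, ncard_partB hE hV, hc.ncard_componentsC hE hV,
      numEdgesBetween_partA_partC hE hV]
    exact h.card_eq
  · intro A' C' hA' hne hC'
    obtain ⟨A'', hA'', rfl⟩ : ∃ A'' : Finset V, A'' ⊆ setA (G.mult V) ∧
        A''.map (Function.Embedding.subtype _) = A' := by
      rw [← hA, Set.subset_image_iff] at hA'
      obtain ⟨s, hs, hs'⟩ := hA'
      refine ⟨s.toFinite.toFinset, fun x hx => hs (by simpa using hx), ?_⟩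
      rw [← coe_inj, coe_map, Set.Finite.coe_toFinset]
      exact hs'
    obtain ⟨L', hL', rfl⟩ : ∃ L' ⊆ (setC (G.mult V)).image c, L'.image (G.labelClass c) = C' := by
      rw [hcomp] at hC'
      exact subset_set_image_iff.1 hC' |>.imp fun s hs => ⟨coe_subset.1 hs.1, hs.2⟩
    have hinj := (labelClass_injOn (G := G) c).mono (coe_subset.2 hL')
    rw [sum_image hinj, card_image_of_injOn hinj, card_map, coe_map]
    refine le_trans (le_of_eq ?_) (h.surplus A'' hA'' (map_nonempty.1 hne) L' hL')
    congr 1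
    exact sum_congr rfl fun l _ => numEdgesBetween_labelClass hE hA'' c l

/-- The components partition C, so e(A, C) is the sum of the e(A, C_i); the rest is linear
arithmetic over ℚ. -/
theorem card_eq_iff (hE : G.edgeSet.Finite) (hV : G.vertexSet = V) :
    2 * G.partA.ncard + G.componentsC.ncard =
        2 * G.partB.ncard + G.numEdgesBetween G.partA G.partC + 2 ↔
      (G.partA.ncard : ℚ) = G.partB.ncard + 1 +
        ∑ᶠ S ∈ G.componentsC, (1 / 2 : ℚ) * ((G.numEdgesBetween G.partA S : ℚ) - 1) := by
  obtain ⟨c, hc⟩ := G.exists_isComponentLabelling V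
  have h1 : ∑ᶠ S ∈ G.componentsC, (1 / 2 : ℚ) * ((G.numEdgesBetween G.partA S : ℚ) - 1) =
      (1 / 2) * (G.numEdgesBetween G.partA G.partC - G.componentsC.ncard) := by
    rw [hc.ncard_componentsC hE hV, hc.componentsC_eq hE hV,
      finsum_mem_image (labelClass_injOn c), finsum_mem_coe_finset, ← mul_sum, sum_sub_distrib,
      numEdgesBetween_partA_partC hE hV]
    have h2 := sum_labelCount (G.mult V) (setB (G.mult V)) (setA (G.mult V)) c
    change ∑ a ∈ setA (G.mult V), ∑ u ∈ setC (G.mult V), G.mult V a u =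
      ∑ l ∈ (setC (G.mult V)).image c, _ at h2
    rw [h2, sum_congr rfl fun l _ => congrArg Nat.cast (numEdgesBetween_partA_labelClass hE hV c l)]
    simp
  rw [h1, ← Nat.cast_inj (R := ℚ)]
  push_cast
  constructor <;> intro h <;> linarith

end Graph

theorem mainTheorem2 {α β : Type*} (G : Graph α β) (hG : G.MemM2) :
    (G.IsMaximalWithoutTwoFactor ↔
      G.IsIndependent G.partA ∧
      (∀ S ∈ G.componentsC, G.IsDoublyComplete S) ∧
      (∀ S ∈ G.componentsC, G.IsMatching (G.edgesBetween G.partA S) ∧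
        Odd (G.numEdgesBetween G.partA S)) ∧
      2 * G.partA.ncard + G.componentsC.ncard =
        2 * G.partB.ncard + G.numEdgesBetween G.partA G.partC + 2 ∧
      (∀ (A' : Finset α) (C' : Finset (Set α)), (A' : Set α) ⊆ G.partA → A'.Nonempty →
        (C' : Set (Set α)) ⊆ G.componentsC →
        2 + ∑ S ∈ C', G.numEdgesBetween (A' : Set α) S ≤ 2 * A'.card + C'.card)) ∧
    (2 * G.partA.ncard + G.componentsC.ncard =
        2 * G.partB.ncard + G.numEdgesBetween G.partA G.partC + 2 ↔
      (G.partA.ncard : ℚ) = G.partB.ncard + 1 +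
        ∑ᶠ S ∈ G.componentsC, (1 / 2 : ℚ) * ((G.numEdgesBetween G.partA S : ℚ) - 1)) := by
  classical
  have : Fintype G.vertexSet := hG.finite_vertexSet.fintype
  have hE := hG.finite_edgeSet
  refine ⟨(hG.isMaximal_iff rfl).trans ?_, Graph.card_eq_iff hE rfl⟩
  change _ ↔ G.StructureConditions
  constructor
  · intro h
    obtain ⟨c, hc⟩ := h.exists_conditions (G.mult_comm _) fun u v huv =>
      hG.ncard_linkSet_le u v fun e => huv (Subtype.ext e)
    exact hc.structureConditions hG rfl
  · intro h
    obtain ⟨c, hc⟩ := G.exists_isComponentLabelling G.vertexSet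
    exact (h.conditions hE rfl hc).isMaximal (G.mult_comm _)
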